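/- Let $A\in\mathbb R^{n\times n}$, $B_u\in\mathbb R^{n\times d}$, $B_w\in\mathbb R^{n\times p}$ with $(A,B_u)$ and $(A,B_w)$ stabilizable, and consider the system $x_{t+1}=Ax_t+B_uu_t+B_ww_{t+1}$, $t\in\mathbb Z$, in coordinates in which the stage cost is $\|x_t\|^2+\|u_t\|^2$. Bi-infinite real block Toeplitz operators $\mathcal X$ with blocks $X_k$ are identified with their symbols $X(z)=\sum_k X_kz^{-k}$, $|z|=1$, so that products, adjoints, inverses and positive square roots are taken pointwise in $z$. Let $\mathrm{Tr}(\mathcal X)=\mathrm{tr}(X_0)=\frac1{2\pi}\int_0^{2\pi}\mathrm{tr}\,X(e^{j\omega})\,d\omega$ be the normalized trace, let $\|\mathcal X\|_{\mathrm{op}}=\operatorname{ess\,sup}_{|z|=1}\|X(z)\|$, and let $\mathcal X\succ0$ mean that for some $\varepsilon>0$, $X(z)-\varepsilon I$ is Hermitian positive semidefinite for almost every $z$. Put $\mathcal F(z)=(zI-A)^{-1}B_u$ and $\mathcal G(z)=z(zI-A)^{-1}B_w$. For a controller $u=\mathcal Kw$ let $$\mathcal T_{\mathcal K}=\begin{bmatrix}\mathcal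 F\mathcal K+\mathcal G\\ \mathcal K\end{bmatrix},\qquad \mathcal K_\circ=-(I+\mathcal F^*\mathcal F)^{-1}\mathcal F^*\mathcal G,\qquad \mathcal C_{\mathcal K}=\mathcal T_{\mathcal K}^*\mathcal T_{\mathcal K}-\mathcal T_{\mathcal K_\circ}^*\mathcal T_{\mathcal K_\circ}.$$ Let $\mathscr K$ be the set of causal controllers: $\mathcal K$ belongs to the Hardy space $H_2$ of real causal block Toeplitz operators (square summable blocks, $K_k=0$ for $k<0$) and so does the closed loop $\mathcal T_{\mathcal K}$ (the latter is automatic if all eigenvalues of $A$ lie in the open unit disc). Let $\gamma_{\mathrm{RO}}=\inf_{\mathcal K\in\mathscr K}\|\mathcal C_{\mathcal K}\|_{\mathrm{op}}$. Then for every real $\gamma>\gamma_{\mathrm{RO}}$, $$\inf_{\substack{\mathcal K\in\mathscr K\\ \gamma I\succ\mathcal C_{\mathcal K}}}\mathrm{Tr}\big((I-\gamma^{-1}\mathcal C_{\mathcal K})^{-1}\big)=\sup_{\mathcal M\succ0}\ \inf_{\mathcal K\in\mathscr K}\Big(-\mathrm{Tr}(\mathcal M)+2\,\mathrm{Tr}(\sqrt{\mathcal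 M})+\gamma^{-1}\mathrm{Tr}(\mathcal C_{\mathcal K}\mathcal M)\Big),$$ where $\mathcal M$ ranges over the bounded real block Toeplitz operators with $\mathcal M\succ0$. -/

import Mathlib

open MeasureTheory
open scoped ENNReal Matrix MatrixOrder ComplexOrder

noncomputable section

namespace DRRO

/-- A (bi-infinite) block Toeplitz operator, represented by its symbol (transfer function)
`z ↦ X(z)` on the unit circle, where `z = e^{2πiθ}` and `θ` runs over `ℝ / ℤ`. The circle carries
the Haar probability measure `AddCircle.haarAddCircle`, i.e. `dω / 2π` in the frequency
`ω = 2πθ`. Products, adjoints and inverses of operators are pointwise for symbols. -/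
abbrev ToeplitzSymbol (m n : Type) : Type := UnitAddCircle → Matrix m n ℂ

/-- The coordinate `z = e^{2πiθ}` on the unit circle. -/
def zvar (θ : UnitAddCircle) : ℂ := fourier 1 θ

/-- The `k`-th block (impulse response) of a block Toeplitz operator, i.e. the block in position
`(s, t)` with `s - t = k`: the coefficient of `z⁻ᵏ` of the symbol. -/
def block {m n : Type} (X : ToeplitzSymbol m n) (k : ℤ) : Matrix m n ℂ :=
  Matrix.of fun i j => fourierCoeff (T := (1 : ℝ)) (fun θ => X θ i j) (-k)

/-- The operator maps real sequences to real sequences: all its blocks are real. -/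
def IsRealOp {m n : Type} (X : ToeplitzSymbol m n) : Prop :=
  ∀ k i j, (block X k i j).im = 0

/-- The operator is causal (block lower triangular). -/
def IsCausalOp {m n : Type} (X : ToeplitzSymbol m n) : Prop :=
  ∀ k : ℤ, k < 0 → block X k = 0

/-- The Hardy space `H₂` of real causal block Toeplitz operators: symbol square integrable
(equivalently, square summable impulse response) and causal. -/
def IsHardy2 {m n : Type} (X : ToeplitzSymbol m n) : Prop :=
  (∀ i j, MemLp (fun θ => X θ i j) 2 (AddCircle.haarAddCircle (T := (1 : ℝ)))) ∧
    IsRealOp X ∧ IsCausalOp X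

/-- Boundedness of a real block Toeplitz operator on `ℓ₂`: essentially bounded symbol. -/
def IsBoundedOp {m n : Type} (X : ToeplitzSymbol m n) : Prop :=
  (∀ i j, MemLp (fun θ => X θ i j) ∞ (AddCircle.haarAddCircle (T := (1 : ℝ)))) ∧ IsRealOp X

/-- The operator norm on `ℓ₂` (the `H_∞` norm): the essential supremum over the circle of the
spectral norm of the symbol; it is `∞` for an unbounded operator. -/
def opNorm {m n : Type} [Fintype m] [Fintype n] [DecidableEq n] (X : ToeplitzSymbol m n) : ℝ≥0∞ :=
  essSup (fun θ => ‖(Matrix.toEuclideanLin (X θ)).toContinuousLinearMap‖ₑ)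
    (AddCircle.haarAddCircle (T := (1 : ℝ)))

/-- The positive-definite ordering `X ≻ 0` for (self-adjoint) operators:
`⟨w, X w⟩ ≥ ε ‖w‖²` for some `ε > 0` and all `w`, i.e. `X(z) ≥ ε I` for almost every `z`. -/
def IsPosDefOp {m : Type} [Fintype m] [DecidableEq m] (X : ToeplitzSymbol m m) : Prop :=
  ∃ ε : ℝ, 0 < ε ∧ ∀ᵐ θ ∂(AddCircle.haarAddCircle (T := (1 : ℝ))),
    (X θ - (ε : ℂ) • (1 : Matrix m m ℂ)).PosSemidef

/-- The normalized trace of a block Toeplitz operator: the trace of its diagonal block. -/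
def normTrace {m : Type} [Fintype m] (X : ToeplitzSymbol m m) : ℝ := (block X 0).trace.re

/-- The positive square root `√M` of a positive operator. -/
def sqrtOp {m : Type} [Fintype m] [DecidableEq m] (M : ToeplitzSymbol m m) : ToeplitzSymbol m m :=
  fun θ => CFC.sqrt (M θ)

/-- `(A, B)` is stabilizable: some state feedback `L` puts all eigenvalues of `A + B L` in the
open unit disc. -/
def Stabilizable {n d : ℕ} (A : Matrix (Fin n) (Fin n) ℝ) (B : Matrix (Fin n) (Fin d) ℝ) : Prop :=
  ∃ L : Matrix (Fin d) (Fin n) ℝ,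
    ∀ s ∈ spectrum ℂ ((A + B * L).map ((↑) : ℝ → ℂ)), ‖s‖ < 1

/-- The linear time-invariant system `x_{t+1} = A x_t + B_u u_t + B_w w_{t+1}`, in coordinates in
which the stage cost is `|x_t|² + |u_t|²`. -/
structure LTISystem (n d p : ℕ) where
  A : Matrix (Fin n) (Fin n) ℝ
  Bu : Matrix (Fin n) (Fin d) ℝ
  Bw : Matrix (Fin n) (Fin p) ℝ

namespace LTISystem

variable {n d p : ℕ} (S : LTISystem n d p)

/-- `(z I - A)⁻¹` (outside the finitely many eigenvalues of `A` on the circle). -/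
def resolvent : ToeplitzSymbol (Fin n) (Fin n) := fun θ =>
  (zvar θ • (1 : Matrix (Fin n) (Fin n) ℂ) - S.A.map ((↑) : ℝ → ℂ))⁻¹

/-- `F(z) = (z I - A)⁻¹ B_u`, the transfer function from the control `u` to the state `x`. -/
def F : ToeplitzSymbol (Fin n) (Fin d) := fun θ => S.resolvent θ * S.Bu.map ((↑) : ℝ → ℂ)

/-- `G(z) = z (z I - A)⁻¹ B_w`, the transfer function from the disturbance `w` to the state. -/
def G : ToeplitzSymbol (Fin n) (Fin p) := fun θ =>
  zvar θ • (S.resolvent θ * S.Bw.map ((↑) : ℝ → ℂ))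

/-- The closed-loop transfer operator `T_K = [F K + G; K]`, from `w` to `(x, u)`. -/
def closedLoop (K : ToeplitzSymbol (Fin d) (Fin p)) : ToeplitzSymbol (Fin n ⊕ Fin d) (Fin p) := fun θ =>
  Matrix.fromRows (S.F θ * K θ + S.G θ) (K θ)

/-- The optimal non-causal controller `K∘ = -(I + F* F)⁻¹ F* G`. -/
def noncausalOpt : ToeplitzSymbol (Fin d) (Fin p) := fun θ =>
  -((1 + (S.F θ)ᴴ * S.F θ)⁻¹ * (S.F θ)ᴴ * S.G θ)

/-- The regret operator `C_K = T_K* T_K - T_{K∘}* T_{K∘}`. -/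
def regretOp (K : ToeplitzSymbol (Fin d) (Fin p)) : ToeplitzSymbol (Fin p) (Fin p) := fun θ =>
  (S.closedLoop K θ)ᴴ * S.closedLoop K θ -
    (S.closedLoop S.noncausalOpt θ)ᴴ * S.closedLoop S.noncausalOpt θ

/-- The causal controllers: `K` lies in `H₂`, and so does the causal closed-loop map `T_K` from
`w` to `(x, u)`. The second condition is automatic when all eigenvalues of `A` lie in the open unit
disc; in general it says that the impulse response of the closed loop, generated by the state
recursion from `x_t = 0` for `t < 0`, is square summable, i.e. that the `H₂` cost of `K` is
finite. -/
def causal : Set (ToeplitzSymbol (Fin d) (Fin p)) :=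
  {K | IsHardy2 K ∧ IsHardy2 (S.closedLoop K)}

/-- The optimal regret `γ_RO = inf_K ‖C_K‖` over causal controllers. -/
def gammaRO : ℝ≥0∞ := ⨅ K ∈ S.causal, opNorm (S.regretOp K)

end LTISystem

end DRRO

end

noncomputable section

set_option linter.unusedSectionVars false

namespace DRRO

/-! Write `P = I - γ⁻¹ C_K` for the slack of a controller. Since `γ⁻¹ C_K = I - P`, the payoff is
the integral over the circle of `2 tr √M - tr (M P)`. Pointwise, `2 tr √M ≤ tr (M P) + tr P⁻¹` for
`P > 0` (`two_mul_re_trace_sqrt_le`), with equality at `M = P⁻²`. This gives weak duality, and also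
the worst `M` for a strictly feasible controller. Completing the square (`regretOp_eq`) shows `C_K ≥
0`, so `P ≤ I` and the worst `M` satisfies `M ≥ I`. Strong duality can therefore be proved over `M ≥
I` alone.

On that set the payoff is a quadratic function of the closed loop, uniformly convex in `L²` with a
modulus independent of `M`, and it is concave in `M`. Uniform convexity replaces compactness in the
minimax principle `exists_forall_le_of_quadratic`: near-optimal controllers form a Cauchy sequence,
and closed loops of causal controllers are closed in `L²` (`exists_causal_tendsto`). The result is a
causal `K` whose payoff is at most the maximin value `v` for every `M ≥ I`.

This `K` need not be strictly feasible. Letting `M` grow in an arbitrary positive direction forces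
`P ≥ 0` almost everywhere (`ae_slack_posSemidef`). Mixing in a little of a strictly feasible `K₀`,
which exists because `γ > γ_RO`, makes the slack uniformly positive. By convexity the primal value
of the mixture is at most `(1 - t) v + t J`, where `J` is the value of `K₀`; let `t → 0`. -/

open Filter Topology in
/-- A minimax principle for payoffs `f x m` that are quadratic and uniformly convex in `x` and
concave-like in `m`: approximate saddle points converge, and the limit is an optimal choice
of `x`. -/
theorem exists_forall_le_of_quadratic {α ι E : Type*} [NormedAddCommGroup E]
    {X : Set α} (τ : α → E) {Y : Set ι} (f : α → ι → ℝ) (comb : α → α → ℝ → α)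
    (q : ι → α → α → ℝ) {c v : ℝ} (b N : ι → ℝ) (hc : 0 < c)
    (comb_mem : ∀ x ∈ X, ∀ y ∈ X, ∀ t, comb x y t ∈ X)
    (hf : ∀ m ∈ Y, ∀ x ∈ X, ∀ y ∈ X, ∀ t,
      f (comb x y t) m = (1 - t) * f x m + t * f y m - t * (1 - t) * q m x y)
    (hq₁ : ∀ m ∈ Y, ∀ x ∈ X, ∀ y ∈ X, c * ‖τ y - τ x‖ ^ 2 ≤ q m x y)
    (hq₂ : ∀ m ∈ Y, ∀ x ∈ X, ∀ y ∈ X, q m x y ≤ N m * ‖τ y - τ x‖ ^ 2)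
    (hb : ∀ m ∈ Y, ∀ x ∈ X, b m ≤ f x m)
    (hconc : ∀ m ∈ Y, ∀ m' ∈ Y, ∀ t ∈ Set.Ioo (0 : ℝ) 1, ∃ m'' ∈ Y, ∀ x ∈ X,
      (1 - t) * f x m + t * f x m' ≤ f x m'')
    (hcomplete : ∀ u : ℕ → α, (∀ k, u k ∈ X) → CauchySeq (τ ∘ u) →
      ∃ x ∈ X, Tendsto (τ ∘ u) atTop (𝓝 (τ x)))
    (hv : ∀ m ∈ Y, ∀ η > 0, ∃ x ∈ X, f x m ≤ v + η)
    (hv' : ∀ η > 0, ∃ m ∈ Y, ∀ x ∈ X, v - η ≤ f x m) :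
    ∃ x ∈ X, ∀ m ∈ Y, f x m ≤ v := by
  -- The offset 2 keeps `t k` in `(0, 1/2]`. Errors of order `t k ^ 2` remain negligible after
  -- division by the mixing weight `t k`.
  set t : ℕ → ℝ := fun k => 1 / ((k : ℝ) + 2) with ht
  have ht0 : ∀ k, 0 < t k := fun k => by positivity
  have ht2 : ∀ k, t k ≤ 1 / 2 := fun k => by
    simp only [ht]; apply one_div_le_one_div_of_le <;> [norm_num; linarith [k.cast_nonneg (α := ℝ)]]
  have htl : Tendsto t atTop (𝓝 0) := by
    have := (tendsto_one_div_add_atTop_nhds_zero_nat (𝕜 := ℝ)).comp (tendsto_add_atTop_nat 1)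
    refine this.congr fun k => ?_
    simp only [ht, Function.comp, Nat.cast_add, Nat.cast_one]; ring_nf
  choose m hmY hm using fun k => hv' (t k ^ 2) (pow_pos (ht0 k) 2)
  choose x hxX hx using fun k => hv (m k) (hmY k) (t k ^ 2) (pow_pos (ht0 k) 2)
  -- Test near-optimality of `m k` at the midpoint of `x k` and `y`: the convexity gap there becomes
  -- quadratic growth away from `x k`.
  have growth : ∀ k, ∀ y ∈ X, v - 3 * t k ^ 2 + c / 2 * ‖τ y - τ (x k)‖ ^ 2 ≤ f y (m k) := by
    intro k y hy
    have h1 := hm k _ (comb_mem _ (hxX k) y hy (1 / 2))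
    rw [hf _ (hmY k) _ (hxX k) y hy] at h1
    have h2 := hq₁ _ (hmY k) _ (hxX k) y hy
    linarith [hx k]
  have sq_add : ∀ a b : E, ‖a - b‖ ^ 2 ≤ 2 * (‖a‖ ^ 2 + ‖b‖ ^ 2) := by
    intro a b
    have := norm_sub_le a b
    nlinarith [sq_nonneg (‖a‖ - ‖b‖), norm_nonneg (a - b), norm_nonneg a, norm_nonneg b]
  have close : ∀ k l, ‖τ (x k) - τ (x l)‖ ^ 2 ≤ 20 / c * (t k ^ 2 + t l ^ 2) := by
    intro k l
    -- A near-minimizer against the average of `m k` and `m l` must be close to both `x k` and `x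
    -- l`.
    obtain ⟨m', hm'Y, hm'⟩ := hconc _ (hmY k) _ (hmY l) (1 / 2) ⟨by norm_num, by norm_num⟩
    obtain ⟨y, hy, hyv⟩ := hv m' hm'Y (t k ^ 2 + t l ^ 2)
      (add_pos (pow_pos (ht0 k) 2) (pow_pos (ht0 l) 2))
    have h1 := growth k y hy
    have h2 := growth l y hy
    have h3 := hm' y hy
    have h4 := sq_add (τ y - τ (x l)) (τ y - τ (x k))
    rw [sub_sub_sub_cancel_left] at h4
    rw [div_mul_eq_mul_div, le_div_iff₀ hc]
    nlinarith
  have cauchy : CauchySeq (τ ∘ x) := by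
    rw [Metric.cauchySeq_iff']
    intro ε hε
    have h0 : Tendsto (fun k => 20 / c * (t k ^ 2 + t k ^ 2)) atTop (𝓝 0) := by
      have := (((htl.pow 2).add (htl.pow 2)).const_mul (20 / c))
      simpa using this
    obtain ⟨n, hn⟩ := (h0.eventually (gt_mem_nhds (pow_pos hε 2))).exists
    refine ⟨n, fun k hk => ?_⟩
    have hkn : t k ≤ t n := by
      simp only [ht]
      apply one_div_le_one_div_of_le (by positivity)
      have : (n : ℝ) ≤ k := by exact_mod_cast hk
      linarith
    have h2 : t k ^ 2 ≤ t n ^ 2 := pow_le_pow_left₀ (ht0 k).le hkn 2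
    rw [dist_eq_norm]
    refine lt_of_pow_lt_pow_left₀ 2 hε.le (((close k n).trans ?_).trans_lt hn)
    gcongr
  obtain ⟨z, hz, hzl⟩ := hcomplete x hxX cauchy
  refine ⟨z, hz, fun m₀ hm₀ => ?_⟩
  -- Perturb `m k` towards `m₀` with weight `t k`. The near-minimizers `y k` of the perturbed
  -- payoffs still converge to `z`, and they are nearly optimal against `m₀`.
  choose m' hm'Y hm' using fun k => hconc _ (hmY k) m₀ hm₀ (t k)
    ⟨ht0 k, by linarith [ht2 k]⟩
  choose y hyX hy using fun k => hv (m' k) (hm'Y k) (t k ^ 2) (pow_pos (ht0 k) 2)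
  have key : ∀ k, f (y k) m₀ ≤ v + 4 * t k ∧
      ‖τ (y k) - τ (x k)‖ ^ 2 ≤ 4 / c * (t k * (v - b m₀) + 4 * t k ^ 2) := by
    intro k
    have h1 := hm' k _ (hyX k)
    have h2 := mul_le_mul_of_nonneg_left (growth k _ (hyX k)) (by linarith [ht2 k] : 0 ≤ 1 - t k)
    have h3 := hb m₀ hm₀ _ (hyX k)
    have h4 := hy k
    have hd : 0 ≤ ‖τ (y k) - τ (x k)‖ ^ 2 := by positivity
    generalize ‖τ (y k) - τ (x k)‖ ^ 2 = d at *
    have h5 : c / 4 * d ≤ (1 - t k) * (c / 2 * d) := by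
      nlinarith [mul_nonneg hc.le hd, ht2 k]
    have h6 : 0 ≤ c / 4 * d := by positivity
    have h7 : 0 ≤ t k ^ 2 * t k := by have := ht0 k; positivity
    constructor
    · have : t k * f (y k) m₀ ≤ t k * (v + 4 * t k) := by nlinarith
      exact le_of_mul_le_mul_left this (ht0 k)
    · have h8 := mul_le_mul_of_nonneg_left h3 (ht0 k).le
      rw [div_mul_eq_mul_div, le_div_iff₀ hc]
      nlinarith
  have hyx : Tendsto (fun k => ‖τ (y k) - τ (x k)‖ ^ 2) atTop (𝓝 0) := by
    have h0 : Tendsto (fun k => 4 / c * (t k * (v - b m₀) + 4 * t k ^ 2)) atTop (𝓝 0) := by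
      have := (((htl.mul_const (v - b m₀)).add ((htl.pow 2).const_mul 4)).const_mul (4 / c))
      simpa using this
    exact squeeze_zero (fun k => by positivity) (fun k => (key k).2) h0
  have hyz : Tendsto (fun k => ‖τ (y k) - τ z‖ ^ 2) atTop (𝓝 0) := by
    have hxz : Tendsto (fun k => ‖τ (x k) - τ z‖ ^ 2) atTop (𝓝 0) := by
      have := (tendsto_iff_norm_sub_tendsto_zero.1 hzl).pow 2
      simpa using this
    have h0 := (hyx.add hxz).const_mul 2
    rw [add_zero, mul_zero] at h0
    refine squeeze_zero (fun k => by positivity) (fun k => ?_) h0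
    have := sq_add (τ (y k) - τ (x k)) (τ z - τ (x k))
    rwa [sub_sub_sub_cancel_right, norm_sub_rev (τ z)] at this
  -- No continuity of `f` is assumed. Extrapolating from `z` beyond `y k` to parameter `1 + s`,
  -- where the payoff is still at least `b m₀`, bounds `f z m₀`; dividing by `s` and letting it grow
  -- removes `b m₀`.
  have main : ∀ s > 0, s * f z m₀ ≤ (1 + s) * v - b m₀ := by
    intro s hs
    have h0 : Tendsto (fun k => (1 + s) * (v + 4 * t k) - b m₀ +
        s * (1 + s) * (N m₀ * ‖τ (y k) - τ z‖ ^ 2)) atTop (𝓝 ((1 + s) * v - b m₀)) := by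
      have := ((((htl.const_mul 4).const_add v).const_mul (1 + s)).sub_const (b m₀)).add
        ((hyz.const_mul (N m₀)).const_mul (s * (1 + s)))
      simpa using this
    refine ge_of_tendsto' h0 fun k => ?_
    have h1 := hb m₀ hm₀ _ (comb_mem z hz _ (hyX k) (1 + s))
    rw [hf m₀ hm₀ z hz _ (hyX k)] at h1
    have h2 := mul_le_mul_of_nonneg_left (hq₂ m₀ hm₀ z hz _ (hyX k))
      (by positivity : 0 ≤ s * (1 + s))
    have h3 := mul_le_mul_of_nonneg_left (key k).1 (by positivity : 0 ≤ 1 + s)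
    linarith
  refine le_of_forall_pos_le_add fun ε hε => ?_
  have hvb : 0 ≤ |v - b m₀| := abs_nonneg _
  have hs : 0 < (|v - b m₀| + 1) / ε := by positivity
  have h1 := main _ hs
  have h2 := le_abs_self (v - b m₀)
  have h3 : (|v - b m₀| + 1) / ε * ε = |v - b m₀| + 1 := by field_simp
  have : (|v - b m₀| + 1) / ε * f z m₀ ≤ (|v - b m₀| + 1) / ε * (v + ε) := by
    rw [mul_add, h3]; linarith
  exact le_of_mul_le_mul_left this hs

/-! ### Positive semidefinite matrices -/

section Matrix

open Matrix

variable {m n : Type*} [Fintype m] [Fintype n]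

lemma _root_.Matrix.PosSemidef.re_trace_nonneg {A : Matrix n n ℂ} (hA : A.PosSemidef) :
    0 ≤ A.trace.re := (Complex.nonneg_iff.1 hA.trace_nonneg).1

lemma _root_.Matrix.PosSemidef.sqrt_mul_self [DecidableEq n] {A : Matrix n n ℂ}
    (hA : A.PosSemidef) : CFC.sqrt A * CFC.sqrt A = A :=
  CFC.sqrt_mul_sqrt_self A hA.nonneg

lemma posSemidef_sqrt [DecidableEq n] (A : Matrix n n ℂ) : (CFC.sqrt A).PosSemidef :=
  (CFC.sqrt_nonneg A).posSemidef

lemma _root_.Matrix.PosSemidef.re_trace_mul_nonneg [DecidableEq n] {A B : Matrix n n ℂ}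
    (hA : A.PosSemidef) (hB : B.PosSemidef) : 0 ≤ (A * B).trace.re := by
  have h := hA.conjTranspose_mul_mul_same (CFC.sqrt B)
  rw [(posSemidef_sqrt B).isHermitian.eq] at h
  have := h.re_trace_nonneg
  rwa [trace_mul_cycle, hB.sqrt_mul_self, trace_mul_comm] at this

/-- Fenchel's inequality for the concave function `M ↦ 2 tr √M`. -/
lemma two_mul_re_trace_sqrt_le [DecidableEq n] {A P : Matrix n n ℂ}
    (hA : A.PosSemidef) (hP : P.PosDef) :
    2 * (CFC.sqrt A).trace.re ≤ (A * P).trace.re + (P⁻¹).trace.re := by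
  set N := CFC.sqrt A with hN
  have hNh : Nᴴ = N := (posSemidef_sqrt A).isHermitian.eq
  have hPh : (P⁻¹)ᴴ = P⁻¹ := hP.inv.isHermitian.eq
  -- Fenchel's inequality is the nonnegative trace of `(N - P⁻¹) P (N - P⁻¹)`, expanded.
  have h := (hP.posSemidef.conjTranspose_mul_mul_same (N - P⁻¹)).re_trace_nonneg
  have hdet : IsUnit P.det := (isUnit_iff_isUnit_det _).1 hP.isUnit
  have e : (N - P⁻¹)ᴴ * P * (N - P⁻¹) = N * P * N - N - N + P⁻¹ := by
    rw [conjTranspose_sub, hNh, hPh]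
    simp only [sub_mul, mul_sub, nonsing_inv_mul _ hdet, mul_assoc, mul_nonsing_inv _ hdet,
      one_mul, mul_one]
    abel
  rw [e, trace_add, trace_sub, trace_sub, trace_mul_cycle, hA.sqrt_mul_self] at h
  simp only [Complex.add_re, Complex.sub_re] at h
  linarith

lemma posDef_of_sub_smul_one [DecidableEq n] {A : Matrix n n ℂ} {ε : ℝ} (hε : 0 < ε)
    (hA : (A - (ε : ℂ) • (1 : Matrix n n ℂ)).PosSemidef) : A.PosDef := by
  have h1 : ((ε : ℂ) • (1 : Matrix n n ℂ)).PosDef := PosDef.one.smul (by exact_mod_cast hε)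
  simpa using h1.posSemidef_add hA

/-- The inverse of the square root supports the concave function `M ↦ tr √M`. -/
lemma re_trace_sqrt_concave [DecidableEq n] {A B : Matrix n n ℂ} (hA : A.PosDef) (hB : B.PosDef)
    {t : ℝ} (ht : t ∈ Set.Ioo (0 : ℝ) 1) :
    (1 - t) * (CFC.sqrt A).trace.re + t * (CFC.sqrt B).trace.re ≤
      (CFC.sqrt (((1 - t : ℝ) : ℂ) • A + (t : ℂ) • B)).trace.re := by
  set D := ((1 - t : ℝ) : ℂ) • A + (t : ℂ) • B with hD
  have hDpos : D.PosDef := (hA.smul (by exact_mod_cast sub_pos.2 ht.2)).add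
    (hB.smul (by exact_mod_cast ht.1))
  have hs : IsUnit (CFC.sqrt D) := by
    have : IsUnit (CFC.sqrt D * CFC.sqrt D) := by
      rw [hDpos.posSemidef.sqrt_mul_self]; exact hDpos.isUnit
    rw [isUnit_iff_isUnit_det, det_mul] at this
    exact (isUnit_iff_isUnit_det _).2 (isUnit_of_mul_isUnit_left this)
  have hs' : (CFC.sqrt D).PosDef := ((posSemidef_sqrt D).posDef_iff_isUnit).2 hs
  -- With `P = (√D)⁻¹` the Fenchel bound is affine in the matrix and sharp at `D`, so averaging it
  -- over `A` and `B` gives concavity.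
  have h1 := two_mul_re_trace_sqrt_le hA.posSemidef hs'.inv
  have h2 := two_mul_re_trace_sqrt_le hB.posSemidef hs'.inv
  have hdet : IsUnit (CFC.sqrt D).det := (isUnit_iff_isUnit_det _).1 hs
  have h3 : D * (CFC.sqrt D)⁻¹ = CFC.sqrt D := by
    nth_rewrite 1 [← hDpos.posSemidef.sqrt_mul_self]
    rw [mul_assoc, mul_nonsing_inv _ hdet, mul_one]
  have h4 : (1 - t) * (A * (CFC.sqrt D)⁻¹).trace.re + t * (B * (CFC.sqrt D)⁻¹).trace.re =
      (CFC.sqrt D).trace.re := by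
    conv_rhs => rw [← h3, hD, add_mul, smul_mul_assoc, smul_mul_assoc, trace_add, trace_smul,
      trace_smul, smul_eq_mul, smul_eq_mul, Complex.add_re, Complex.re_ofReal_mul,
      Complex.re_ofReal_mul, ← hD]
  rw [nonsing_inv_nonsing_inv _ hdet] at h1 h2
  nlinarith [ht.1, ht.2, mul_le_mul_of_nonneg_left h1 (sub_pos.2 ht.2).le,
    mul_le_mul_of_nonneg_left h2 ht.1.le]

/-- The 2×2 minor on rows and columns `i`, `j` is nonnegative, so `|A i j|² ≤ A i i * A j j`. -/
lemma _root_.Matrix.PosSemidef.norm_apply_le [DecidableEq n] {A : Matrix n n ℂ}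
    (hA : A.PosSemidef) {c : ℝ} (hc : ∀ i, (A i i).re ≤ c) (i j : n) : ‖A i j‖ ≤ c := by
  have hd : ∀ i, 0 ≤ (A i i).re := fun i => (Complex.nonneg_iff.1 hA.diag_nonneg).1
  have h := hA.submatrix ![i, j]
  have hdet := (Complex.nonneg_iff.1 h.det_nonneg).1
  have hii : (A i i).im = 0 := (Complex.nonneg_iff.1 (hA.diag_nonneg (i := i))).2.symm
  have hsym : A j i = star (A i j) := (hA.isHermitian.apply j i).symm
  rw [det_fin_two] at hdet
  simp [hii, hsym, Complex.mul_conj, Complex.normSq_eq_norm_sq] at hdet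
  norm_cast at hdet
  have h1 : ‖A i j‖ ^ 2 ≤ c ^ 2 := by nlinarith [hc i, hc j, hd i, hd j]
  exact le_of_sq_le_sq h1 ((hd i).trans (hc i))

lemma norm_sq_apply_le (A : Matrix m n ℂ) (i : m) (j : n) :
    ‖A i j‖ ^ 2 ≤ ((Aᴴ * A) j j).re := by
  rw [mul_apply, Complex.re_sum]
  have : ∀ k, (Aᴴ j k * A k j).re = ‖A k j‖ ^ 2 := fun k => by
    simp [conjTranspose_apply, Complex.sq_norm, Complex.normSq_apply]
  simp only [this]
  exact Finset.single_le_sum (f := fun k => ‖A k j‖ ^ 2) (fun k _ => by positivity)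
    (Finset.mem_univ i)

lemma re_trace_conjTranspose_mul_self (A : Matrix m n ℂ) :
    (Aᴴ * A).trace.re = ∑ j, ∑ i, ‖A i j‖ ^ 2 := by
  simp only [trace, diag, mul_apply, Complex.re_sum]
  refine Finset.sum_congr rfl fun j _ => Finset.sum_congr rfl fun k _ => ?_
  simp [conjTranspose_apply, Complex.sq_norm, Complex.normSq_apply]

end Matrix

/-! ### Measurability -/

section Measurability

-- The C⋆-norm serves only to reach continuity of the functional calculus; its topology is the
-- entrywise one.
open scoped Matrix.Norms.L2Operator in
lemma continuousOn_matrix_sqrt {n : Type} [Fintype n] [DecidableEq n] :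
    ContinuousOn (CFC.sqrt : Matrix n n ℂ → Matrix n n ℂ) {A | A.PosSemidef} := by
  have := CFC.continuousOn_sqrt (A := Matrix n n ℂ)
  simpa only [Matrix.nonneg_iff_posSemidef] using this

end Measurability

/-- The Haar probability measure on the circle of frequencies. -/
abbrev circleHaar : Measure UnitAddCircle := AddCircle.haarAddCircle (T := (1 : ℝ))

section Measurability

open Matrix

variable {l m n : Type} [Fintype l] [Fintype m] [Fintype n]
  {α : Type*} [MeasurableSpace α] {μ : Measure α}

instance : SecondCountableTopology (Matrix m n ℂ) :=
  inferInstanceAs (SecondCountableTopology (m → n → ℂ))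

instance : TopologicalSpace.PseudoMetrizableSpace (Matrix m n ℂ) :=
  inferInstanceAs (TopologicalSpace.PseudoMetrizableSpace (m → n → ℂ))

lemma aestronglyMeasurable_apply {X : α → Matrix m n ℂ} (hX : AEStronglyMeasurable X μ) (i : m)
    (j : n) : AEStronglyMeasurable (fun θ => X θ i j) μ :=
  (continuous_id.matrix_elem i j).comp_aestronglyMeasurable hX

lemma aestronglyMeasurable_of_apply {X : α → Matrix m n ℂ}
    (hX : ∀ i j, AEStronglyMeasurable (fun θ => X θ i j) μ) : AEStronglyMeasurable X μ := by
  classical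
  have : X = fun θ => ∑ i, ∑ j, Matrix.single i j (X θ i j) := by
    funext θ; exact matrix_eq_sum_single _
  rw [this]
  refine Finset.aestronglyMeasurable_fun_sum _ fun i _ =>
    Finset.aestronglyMeasurable_fun_sum _ fun j _ => ?_
  have hc : Continuous fun c : ℂ => (Matrix.single i j c : Matrix m n ℂ) := by
    refine continuous_matrix fun k l => ?_
    simp only [Matrix.single_apply]
    split_ifs <;> fun_prop
  exact hc.comp_aestronglyMeasurable (hX i j)

lemma aestronglyMeasurable_matrix_mul {X : α → Matrix l m ℂ} {Y : α → Matrix m n ℂ}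
    (hX : AEStronglyMeasurable X μ) (hY : AEStronglyMeasurable Y μ) :
    AEStronglyMeasurable (fun θ => X θ * Y θ) μ :=
  (continuous_fst.matrix_mul continuous_snd).comp_aestronglyMeasurable (hX.prodMk hY)

lemma aestronglyMeasurable_conjTranspose {X : α → Matrix m n ℂ} (hX : AEStronglyMeasurable X μ) :
    AEStronglyMeasurable (fun θ => (X θ)ᴴ) μ :=
  continuous_id.matrix_conjTranspose.comp_aestronglyMeasurable hX

lemma aestronglyMeasurable_inv [DecidableEq n] {X : α → Matrix n n ℂ}
    (hX : AEStronglyMeasurable X μ) : AEStronglyMeasurable (fun θ => (X θ)⁻¹) μ := by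
  simp only [Matrix.inv_def, Ring.inverse_eq_inv']
  have h1 := continuous_id.matrix_det.comp_aestronglyMeasurable hX
  have h2 := continuous_id.matrix_adjugate.comp_aestronglyMeasurable hX
  exact (h1.aemeasurable.inv.aestronglyMeasurable).smul h2

-- `CFC.sqrt` is continuous on the closed cone of positive semidefinite matrices and takes the
-- default value 0 elsewhere, hence is Borel.
open Classical in
lemma aestronglyMeasurable_sqrt [DecidableEq n] {X : α → Matrix n n ℂ}
    (hX : AEStronglyMeasurable X μ) : AEStronglyMeasurable (fun θ => CFC.sqrt (X θ)) μ := by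
  borelize (Matrix n n ℂ)
  have hcl : IsClosed {A : Matrix n n ℂ | A.PosSemidef} := by
    simp only [posSemidef_iff_dotProduct_mulVec, IsHermitian, Set.ofPred_and, Set.ofPred_forall]
    refine (isClosed_eq continuous_id.matrix_conjTranspose continuous_id).inter
      (isClosed_iInter fun x => ?_)
    have hc : Continuous fun A : Matrix n n ℂ => star x ⬝ᵥ A *ᵥ x :=
      Continuous.dotProduct continuous_const (continuous_id.matrix_mulVec continuous_const)
    exact (isClosed_le continuous_const hc)
  have hs : Measurable (CFC.sqrt : Matrix n n ℂ → Matrix n n ℂ) := by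
    have h := ContinuousOn.measurable_piecewise (f := CFC.sqrt) (g := 0)
      continuousOn_matrix_sqrt (continuousOn_const (c := (0 : Matrix n n ℂ))) hcl.measurableSet
    convert h using 1
    funext A
    by_cases hA : A.PosSemidef
    · rw [Set.piecewise_eq_of_mem _ _ _ (by exact hA)]
    · rw [Set.piecewise_eq_of_notMem _ _ _ (by exact hA)]
      exact CFC.sqrt_of_not_nonneg fun h => hA h.posSemidef
  exact (hs.comp_aemeasurable hX.aemeasurable).aestronglyMeasurable

end Measurability

/-! ### Integrability classes of symbols -/

section Integrability

open Matrix

variable {l m n : Type} [Fintype l] [Fintype m] [Fintype n]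

/-- Entrywise integrability. -/
def IsL1 (X : ToeplitzSymbol m n) : Prop := ∀ i j, Integrable (fun θ => X θ i j) circleHaar

/-- Entrywise square integrability. -/
def IsL2 (X : ToeplitzSymbol m n) : Prop := ∀ i j, MemLp (fun θ => X θ i j) 2 circleHaar

/-- Entrywise essential boundedness. -/
def IsLinf (X : ToeplitzSymbol m n) : Prop := ∀ i j, MemLp (fun θ => X θ i j) ∞ circleHaar

lemma IsL2.aestronglyMeasurable {X : ToeplitzSymbol m n} (hX : IsL2 X) :
    AEStronglyMeasurable X circleHaar :=
  aestronglyMeasurable_of_apply fun i j => (hX i j).1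

lemma IsLinf.aestronglyMeasurable {X : ToeplitzSymbol m n} (hX : IsLinf X) :
    AEStronglyMeasurable X circleHaar :=
  aestronglyMeasurable_of_apply fun i j => (hX i j).1

lemma IsL1.aestronglyMeasurable {X : ToeplitzSymbol m n} (hX : IsL1 X) :
    AEStronglyMeasurable X circleHaar :=
  aestronglyMeasurable_of_apply fun i j => (hX i j).1

lemma IsLinf.isL2 {X : ToeplitzSymbol m n} (hX : IsLinf X) : IsL2 X :=
  fun i j => (hX i j).mono_exponent le_top

lemma IsL2.isL1 {X : ToeplitzSymbol m n} (hX : IsL2 X) : IsL1 X :=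
  fun i j => (hX i j).integrable (by norm_num)

lemma isLinf_of_bound {X : ToeplitzSymbol m n} (hX : AEStronglyMeasurable X circleHaar) (c : ℝ)
    (h : ∀ᵐ θ ∂circleHaar, ∀ i j, ‖X θ i j‖ ≤ c) : IsLinf X := fun i j =>
  memLp_top_of_bound (aestronglyMeasurable_apply hX i j) c (h.mono fun _ h => h i j)

lemma isLinf_const (A : Matrix m n ℂ) : IsLinf fun _ => A := fun i j => memLp_const (A i j)

lemma IsL1.add {X Y : ToeplitzSymbol m n} (hX : IsL1 X) (hY : IsL1 Y) :
    IsL1 fun θ => X θ + Y θ := fun i j => (hX i j).add (hY i j)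

lemma IsL1.sub {X Y : ToeplitzSymbol m n} (hX : IsL1 X) (hY : IsL1 Y) :
    IsL1 fun θ => X θ - Y θ := fun i j => (hX i j).sub (hY i j)

lemma IsL1.smul {X : ToeplitzSymbol m n} (hX : IsL1 X) (c : ℂ) :
    IsL1 fun θ => c • X θ := fun i j => (hX i j).const_mul c

lemma IsL2.add {X Y : ToeplitzSymbol m n} (hX : IsL2 X) (hY : IsL2 Y) :
    IsL2 fun θ => X θ + Y θ := fun i j => (hX i j).add (hY i j)

lemma IsL2.sub {X Y : ToeplitzSymbol m n} (hX : IsL2 X) (hY : IsL2 Y) :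
    IsL2 fun θ => X θ - Y θ := fun i j => (hX i j).sub (hY i j)

lemma IsL2.smul {X : ToeplitzSymbol m n} (hX : IsL2 X) (c : ℂ) :
    IsL2 fun θ => c • X θ := fun i j => (hX i j).const_mul c

lemma IsLinf.add {X Y : ToeplitzSymbol m n} (hX : IsLinf X) (hY : IsLinf Y) :
    IsLinf fun θ => X θ + Y θ := fun i j => (hX i j).add (hY i j)

lemma IsLinf.smul {X : ToeplitzSymbol m n} (hX : IsLinf X) (c : ℂ) :
    IsLinf fun θ => c • X θ := fun i j => (hX i j).const_mul c

lemma IsL1.mul {X : ToeplitzSymbol l m} {Y : ToeplitzSymbol m n} (hX : IsL1 X) (hY : IsLinf Y) :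
    IsL1 fun θ => X θ * Y θ := fun i j => by
  simp only [mul_apply]
  exact integrable_finsetSum _ fun k _ => (hX i k).mul_of_top_left (hY k j)

lemma IsL2.conjTranspose {X : ToeplitzSymbol l m} (hX : IsL2 X) : IsL2 fun θ => (X θ)ᴴ :=
  fun i j => (hX j i).star

lemma IsL2.mul {X : ToeplitzSymbol l m} {Y : ToeplitzSymbol m n} (hX : IsL2 X) (hY : IsL2 Y) :
    IsL1 fun θ => X θ * Y θ := fun i j => by
  simp only [mul_apply]
  exact integrable_finsetSum _ fun k _ => (hX i k).integrable_mul (hY k j)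

lemma IsL1.re_trace {X : ToeplitzSymbol n n} (hX : IsL1 X) :
    Integrable (fun θ => (X θ).trace.re) circleHaar := by
  simp only [trace, diag]
  exact (integrable_finsetSum _ fun k _ => hX k k).re

lemma IsL1.normTrace_eq {X : ToeplitzSymbol n n} (hX : IsL1 X) :
    normTrace X = ∫ θ, (X θ).trace.re ∂circleHaar := by
  simp only [normTrace, block, trace, diag, of_apply, fourierCoeff, neg_zero, fourier_zero,
    one_smul, Complex.re_sum]
  refine Eq.trans ?_ (integral_finsetSum _ fun k _ => (hX k k).re).symm
  exact Finset.sum_congr rfl fun k _ => (integral_re (hX k k)).symm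

lemma isL2_of_conjTranspose_mul_self_le {X : ToeplitzSymbol l n} {Y : ToeplitzSymbol m n}
    (hX : AEStronglyMeasurable X circleHaar) (hY : IsL2 Y)
    (h : ∀ᵐ θ ∂circleHaar, ((Y θ)ᴴ * Y θ - (X θ)ᴴ * X θ).PosSemidef) : IsL2 X := fun i j => by
  have hXij := aestronglyMeasurable_apply hX i j
  rw [memLp_two_iff_integrable_sq_norm hXij]
  refine ((hY.conjTranspose.mul hY) j j).re.mono' (hXij.norm.pow 2) (h.mono fun θ hθ => ?_)
  have h1 := (Complex.nonneg_iff.1 (hθ.diag_nonneg (i := j))).1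
  rw [Matrix.sub_apply, Complex.sub_re, sub_nonneg] at h1
  rw [Real.norm_of_nonneg (by positivity)]
  exact (norm_sq_apply_le _ i j).trans h1

/-- Each squared entry of `√X` is dominated by a diagonal entry of `√X √X = X`. -/
lemma IsL1.sqrtOp [DecidableEq n] {X : ToeplitzSymbol n n} (hX : IsL1 X)
    (hpos : ∀ᵐ θ ∂circleHaar, (X θ).PosSemidef) : IsL2 (sqrtOp X) := fun i j => by
  have hm := aestronglyMeasurable_sqrt hX.aestronglyMeasurable
  have hij := aestronglyMeasurable_apply hm i j
  refine (memLp_two_iff_integrable_sq_norm hij).2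
    ((hX j j).re.mono' (hij.norm.pow 2) (hpos.mono fun θ hθ => ?_))
  rw [Real.norm_of_nonneg (by positivity)]
  refine (norm_sq_apply_le _ i j).trans_eq ?_
  rw [(posSemidef_sqrt _).isHermitian.eq, hθ.sqrt_mul_self]
  rfl

end Integrability

/-! ### Real operators and conjugate-symmetric symbols -/

section Reality

open Matrix Filter

variable {l m n : Type} [Fintype l] [Fintype m] [Fintype n]

/-- The symmetry `X(z̄) = conj X(z)` of the symbol of a real operator. -/
def IsConjSymm (X : ToeplitzSymbol m n) : Prop :=
  ∀ᵐ θ ∂circleHaar, X (-θ) = (X θ).map (starRingEnd ℂ)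

lemma ae_neg {p : UnitAddCircle → Prop} (h : ∀ᵐ θ ∂circleHaar, p θ) : ∀ᵐ θ ∂circleHaar, p (-θ) :=
  (Measure.measurePreserving_neg circleHaar).quasiMeasurePreserving.ae h

lemma fourierCoeff_conj_neg (f : UnitAddCircle → ℂ) (k : ℤ) :
    fourierCoeff (T := (1 : ℝ)) (fun θ => starRingEnd ℂ (f (-θ))) k =
      starRingEnd ℂ (fourierCoeff (T := (1 : ℝ)) f k) := by
  simp only [fourierCoeff, smul_eq_mul]
  rw [← integral_conj, ← integral_neg_eq_self _ circleHaar]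
  refine integral_congr_ae (Eventually.of_forall fun θ => ?_)
  simp only [neg_neg, map_mul, ← fourier_neg]
  simp only [fourier_apply, smul_neg, neg_smul, neg_neg]

lemma IsConjSymm.isRealOp {X : ToeplitzSymbol m n} (hX : IsConjSymm X) : IsRealOp X := by
  intro k i j
  rw [← Complex.conj_eq_iff_im]
  simp only [block, of_apply]
  rw [← fourierCoeff_conj_neg]
  refine congrFun (fourierCoeff_congr_ae ?_) _
  filter_upwards [hX] with θ hθ
  rw [hθ]; simp

lemma ae_eq_of_fourierCoeff_eq {f g : UnitAddCircle → ℂ} (hf : MemLp f 2 circleHaar)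
    (hg : MemLp g 2 circleHaar)
    (h : ∀ k, fourierCoeff (T := (1 : ℝ)) f k = fourierCoeff (T := (1 : ℝ)) g k) :
    f =ᵐ[circleHaar] g := by
  have : hf.toLp f = hg.toLp g := by
    apply fourierBasis.repr.injective
    ext k
    rw [fourierBasis_repr, fourierBasis_repr, fourierCoeff_congr_ae hf.coeFn_toLp,
      fourierCoeff_congr_ae hg.coeFn_toLp, h]
  exact hf.coeFn_toLp.symm.trans (this ▸ hg.coeFn_toLp)

/-- `X(θ)` and the conjugate of `X(-θ)` have the same Fourier coefficients, which determine an `L²`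
function. -/
lemma IsRealOp.isConjSymm {X : ToeplitzSymbol m n} (hX : IsRealOp X) (h2 : IsL2 X) :
    IsConjSymm X := by
  have : ∀ i j, ∀ᵐ θ ∂circleHaar, X θ i j = starRingEnd ℂ (X (-θ) i j) := by
    intro i j
    refine ae_eq_of_fourierCoeff_eq (h2 i j) ?_ fun k => ?_
    · exact ((h2 i j).comp_measurePreserving (Measure.measurePreserving_neg circleHaar)).star
    · refine Eq.trans ?_ (fourierCoeff_conj_neg (fun θ => X θ i j) k).symm
      have := hX (-k) i j
      simp only [block, of_apply, neg_neg] at this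
      exact (Complex.conj_eq_iff_im.2 this).symm
  filter_upwards [ae_all_iff.2 fun i => ae_all_iff.2 (this i)] with θ hθ
  ext i j
  simp [hθ]

lemma map_conj_mul (A : Matrix l m ℂ) (B : Matrix m n ℂ) :
    (A * B).map (starRingEnd ℂ) = A.map (starRingEnd ℂ) * B.map (starRingEnd ℂ) :=
  Matrix.map_mul

lemma map_conj_eq (A : Matrix m n ℂ) : A.map (starRingEnd ℂ) = Aᴴᵀ := rfl

lemma map_conj_inv [DecidableEq n] (A : Matrix n n ℂ) :
    (A⁻¹).map (starRingEnd ℂ) = (A.map (starRingEnd ℂ))⁻¹ := by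
  rw [map_conj_eq, map_conj_eq, conjTranspose_nonsing_inv, transpose_nonsing_inv]

lemma map_conj_conjTranspose (A : Matrix m n ℂ) :
    (Aᴴ).map (starRingEnd ℂ) = (A.map (starRingEnd ℂ))ᴴ := rfl

lemma trace_map_conj (A : Matrix n n ℂ) :
    (A.map (starRingEnd ℂ)).trace = starRingEnd ℂ A.trace := by
  simp [trace, map_sum]

lemma map_conj_one [DecidableEq n] : (1 : Matrix n n ℂ).map (starRingEnd ℂ) = 1 := by simp

lemma map_conj_smul_real (c : ℝ) (A : Matrix m n ℂ) :
    ((c : ℂ) • A).map (starRingEnd ℂ) = (c : ℂ) • A.map (starRingEnd ℂ) := by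
  ext; simp

lemma map_conj_add (A B : Matrix m n ℂ) :
    (A + B).map (starRingEnd ℂ) = A.map (starRingEnd ℂ) + B.map (starRingEnd ℂ) := by
  ext; simp

lemma map_conj_sub (A B : Matrix m n ℂ) :
    (A - B).map (starRingEnd ℂ) = A.map (starRingEnd ℂ) - B.map (starRingEnd ℂ) := by
  ext; simp

lemma map_conj_map_ofReal (A : Matrix m n ℝ) :
    (A.map ((↑) : ℝ → ℂ)).map (starRingEnd ℂ) = A.map ((↑) : ℝ → ℂ) := by
  ext; simp

end Reality

/-! ### Further matrix inequalities -/

section MatrixInequalities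

open Matrix

variable {m n : Type*} [Fintype m] [Fintype n] [DecidableEq n]

lemma _root_.Matrix.PosSemidef.smul_ofReal {A : Matrix n n ℂ} (hA : A.PosSemidef) {c : ℝ}
    (hc : 0 ≤ c) : ((c : ℂ) • A).PosSemidef := hA.smul (by exact_mod_cast hc)

/-- With `R = P - ε I`, the difference is `ε⁻¹ P⁻¹ (R² + ε R) P⁻¹`, because `P² - ε P = R² + ε R`.
-/
lemma posSemidef_inv_smul_sub_inv {P : Matrix n n ℂ} {ε : ℝ} (hε : 0 < ε)
    (hP : (P - (ε : ℂ) • (1 : Matrix n n ℂ)).PosSemidef) :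
    (((ε⁻¹ : ℝ) : ℂ) • (1 : Matrix n n ℂ) - P⁻¹).PosSemidef := by
  have hpd := posDef_of_sub_smul_one hε hP
  have hdet : IsUnit P.det := (isUnit_iff_isUnit_det _).1 hpd.isUnit
  set R := P - (ε : ℂ) • (1 : Matrix n n ℂ) with hR
  have h1 : (Rᴴ * R + (ε : ℂ) • R).PosSemidef :=
    (posSemidef_conjTranspose_mul_self R).add (hP.smul_ofReal hε.le)
  have h2 := (h1.conjTranspose_mul_mul_same P⁻¹).smul_ofReal (inv_nonneg.2 hε.le)
  have e1 : Rᴴ * R + (ε : ℂ) • R = P * P - (ε : ℂ) • P := by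
    rw [hP.isHermitian.eq, hR]
    simp only [sub_mul, mul_sub, smul_mul_assoc, mul_smul_comm, one_mul, mul_one, smul_sub]
    abel
  have hε' : (ε : ℂ) ≠ 0 := by exact_mod_cast hε.ne'
  rw [hpd.inv.isHermitian.eq, e1] at h2
  convert h2 using 1
  rw [mul_sub, sub_mul, mul_smul_comm, nonsing_inv_mul_cancel_left _ _ hdet,
    nonsing_inv_mul _ hdet, mul_nonsing_inv _ hdet, smul_mul_assoc, one_mul, smul_sub, smul_smul]
  simp [hε']

lemma norm_inv_apply_le {P : Matrix n n ℂ} {ε : ℝ} (hε : 0 < ε)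
    (hP : (P - (ε : ℂ) • (1 : Matrix n n ℂ)).PosSemidef) (i j : n) : ‖P⁻¹ i j‖ ≤ ε⁻¹ := by
  refine (posDef_of_sub_smul_one hε hP).inv.posSemidef.norm_apply_le (fun k => ?_) i j
  have h := (Complex.nonneg_iff.1 ((posSemidef_inv_smul_sub_inv hε hP).diag_nonneg (i := k))).1
  simpa [Matrix.sub_apply, Matrix.smul_apply] using h

/-- Use `P⁻¹ - 1 = (1 - P) + (1 - P) P⁻¹ (1 - P)`, then `P⁻² - 1 = (P⁻¹ - 1)² + 2 (P⁻¹ - 1)`. This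
puts the worst-case `M` in `geOne`. -/
lemma posSemidef_inv_mul_inv_sub_one {P : Matrix n n ℂ} (hP : P.PosDef)
    (h : (1 - P).PosSemidef) : (P⁻¹ * P⁻¹ - 1).PosSemidef := by
  have hdet : IsUnit P.det := (isUnit_iff_isUnit_det _).1 hP.isUnit
  have h1 : (P⁻¹ - 1).PosSemidef := by
    have h2 := h.add (hP.inv.posSemidef.conjTranspose_mul_mul_same (1 - P))
    convert h2 using 1
    rw [h.isHermitian.eq]
    simp only [sub_mul, mul_sub, nonsing_inv_mul _ hdet,
      mul_nonsing_inv _ hdet, one_mul, mul_one]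
    abel
  have h2 := (posSemidef_conjTranspose_mul_self (P⁻¹ - 1)).add (h1.add h1)
  convert h2 using 1
  rw [h1.isHermitian.eq]
  simp only [sub_mul, mul_sub, one_mul, mul_one]
  abel

/-- Every entry of `A` is at most its trace. The constant is crude: the minimax principle needs only
some finite upper bound on the quadratic form. -/
lemma _root_.Matrix.PosSemidef.re_trace_mul_le {A B : Matrix n n ℂ} (hA : A.PosSemidef) {c : ℝ}
    (hB : ∀ i j, ‖B i j‖ ≤ c) :
    (A * B).trace.re ≤ Fintype.card n ^ 2 * c * A.trace.re := by
  have hd : ∀ i, 0 ≤ (A i i).re := fun i => (Complex.nonneg_iff.1 hA.diag_nonneg).1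
  have hA' := hA.norm_apply_le (c := A.trace.re) fun i => by
    rw [trace, Complex.re_sum]
    exact Finset.single_le_sum (f := fun k => (A.diag k).re) (fun k _ => hd k) (Finset.mem_univ i)
  have : ∀ i j, (A i j * B j i).re ≤ A.trace.re * c := fun i j => by
    refine (Complex.re_le_norm _).trans ?_
    rw [norm_mul]
    exact mul_le_mul (hA' i j) (hB j i) (norm_nonneg _) hA.re_trace_nonneg
  calc (A * B).trace.re = ∑ i, ∑ j, (A i j * B j i).re := by
        simp [trace, mul_apply, Complex.re_sum]
    _ ≤ ∑ _i : n, ∑ _j : n, A.trace.re * c :=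
        Finset.sum_le_sum fun i _ => Finset.sum_le_sum fun j _ => this i j
    _ = _ := by simp; ring

lemma _root_.Matrix.PosSemidef.re_trace_le_re_trace_mul {A B : Matrix n n ℂ} (hA : A.PosSemidef)
    (hB : (B - 1).PosSemidef) : A.trace.re ≤ (A * B).trace.re := by
  have h := hA.re_trace_mul_nonneg hB
  rw [mul_sub, mul_one, trace_sub, Complex.sub_re] at h
  linarith

lemma posSemidef_smul_one_sub_of_norm_le {A : Matrix n n ℂ} (hA : A.IsHermitian) {r : ℝ}
    (h : ‖(Matrix.toEuclideanLin A).toContinuousLinearMap‖ ≤ r) :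
    ((r : ℂ) • (1 : Matrix n n ℂ) - A).PosSemidef := by
  have hH : ((r : ℂ) • (1 : Matrix n n ℂ) - A).IsHermitian := by
    refine IsHermitian.sub ?_ hA
    rw [IsHermitian, conjTranspose_smul, conjTranspose_one]; simp
  refine PosSemidef.of_dotProduct_mulVec_nonneg hH fun x => ?_
  refine Complex.nonneg_iff.2 ⟨?_, (hH.im_star_dotProduct_mulVec_self x).symm⟩
  set y : EuclideanSpace ℂ n := WithLp.toLp 2 x
  have h1 : (star x ⬝ᵥ A *ᵥ x).re ≤ r * ‖y‖ ^ 2 := by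
    have e : star x ⬝ᵥ A *ᵥ x = inner ℂ y (Matrix.toEuclideanLin A y) := by
      rw [EuclideanSpace.inner_eq_star_dotProduct, dotProduct_comm]; rfl
    rw [e]
    calc _ ≤ ‖inner ℂ y (Matrix.toEuclideanLin A y)‖ := Complex.re_le_norm _
      _ ≤ ‖y‖ * ‖Matrix.toEuclideanLin A y‖ := norm_inner_le_norm _ _
      _ ≤ ‖y‖ * (r * ‖y‖) := by
        gcongr
        exact ((Matrix.toEuclideanLin A).toContinuousLinearMap.le_opNorm y).trans (by gcongr)
      _ = _ := by ring
  have h2 : (star x ⬝ᵥ x) = ((‖y‖ ^ 2 : ℝ) : ℂ) := by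
    have := inner_self_eq_norm_sq_to_K (𝕜 := ℂ) y
    rw [EuclideanSpace.inner_eq_star_dotProduct, dotProduct_comm] at this
    rw [Complex.ofReal_pow]
    exact this
  rw [sub_mulVec, smul_mulVec, one_mulVec, dotProduct_sub, dotProduct_smul, h2, Complex.sub_re,
    smul_eq_mul, ← Complex.ofReal_mul, Complex.ofReal_re]
  linarith

end MatrixInequalities

/-! ### Testing positivity against bounded symbols -/

section Integration

open Matrix Filter

variable {m n : Type} [Fintype m] [Fintype n] [DecidableEq n]

lemma IsLinf.exists_bound {X : ToeplitzSymbol m n} (hX : IsLinf X) :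
    ∃ c : ℝ, ∀ᵐ θ ∂circleHaar, ∀ i j, ‖X θ i j‖ ≤ c := by
  refine ⟨∑ i, ∑ j, (eLpNormEssSup (fun θ => X θ i j) circleHaar).toReal, ?_⟩
  refine ae_all_iff.2 fun i => ae_all_iff.2 fun j => ?_
  have hfin : eLpNormEssSup (fun θ => X θ i j) circleHaar ≠ ∞ := by
    have := (hX i j).2
    rw [eLpNorm_exponent_top] at this
    exact this.ne
  filter_upwards [ae_le_eLpNormEssSup (f := fun θ => X θ i j) (μ := circleHaar)] with θ hθ
  have h1 : ‖X θ i j‖ ≤ (eLpNormEssSup (fun θ => X θ i j) circleHaar).toReal := by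
    rw [← toReal_enorm]
    exact ENNReal.toReal_mono hfin hθ
  refine h1.trans ?_
  refine le_trans ?_ (Finset.single_le_sum
    (f := fun i => ∑ j, (eLpNormEssSup (fun θ => X θ i j) circleHaar).toReal)
    (fun k _ => Finset.sum_nonneg fun _ _ => ENNReal.toReal_nonneg) (Finset.mem_univ i))
  exact Finset.single_le_sum
    (f := fun j => (eLpNormEssSup (fun θ => X θ i j) circleHaar).toReal)
    (fun k _ => ENNReal.toReal_nonneg) (Finset.mem_univ j)

lemma isLinf_smul {h : UnitAddCircle → ℝ} (hm : AEStronglyMeasurable h circleHaar)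
    (h1 : ∀ θ, |h θ| ≤ 1) (A : Matrix n n ℂ) : IsLinf fun θ => (h θ : ℂ) • A := fun i j => by
  refine memLp_top_of_bound
    ((Complex.continuous_ofReal.comp_aestronglyMeasurable hm).mul_const (A i j)) (‖A i j‖)
    (Eventually.of_forall fun θ => ?_)
  change ‖(h θ : ℂ) * A i j‖ ≤ _
  rw [norm_mul, Complex.norm_real]
  exact mul_le_of_le_one_left (norm_nonneg _) (h1 θ)

/-- A symmetric Hermitian symbol is almost everywhere positive semidefinite if it pairs
nonnegatively with all positive real bounded symbols. -/
lemma ae_posSemidef_of_integral_nonneg {X : ToeplitzSymbol n n} (hX : IsL1 X)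
    (hH : ∀ᵐ θ ∂circleHaar, (X θ).IsHermitian) (hsymm : IsConjSymm X)
    (h : ∀ H : ToeplitzSymbol n n, IsLinf H → IsConjSymm H → (∀ θ, (H θ).PosSemidef) →
      0 ≤ ∫ θ, (X θ * H θ).trace.re ∂circleHaar) :
    ∀ᵐ θ ∂circleHaar, (X θ).PosSemidef := by
  have key : ∀ v : n → ℂ, ∀ᵐ θ ∂circleHaar, 0 ≤ (star v ⬝ᵥ X θ *ᵥ v).re := by
    intro v
    set g : UnitAddCircle → ℝ := fun θ => (star v ⬝ᵥ X θ *ᵥ v).re with hg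
    have htr : ∀ θ, (X θ * vecMulVec v (star v)).trace.re = g θ := fun θ => by
      rw [mul_vecMulVec, trace_vecMulVec, dotProduct_comm]
    -- A bounded continuous weight supported on negative values, so that `φ (g θ) * g θ ≤ 0`,
    -- strictly where `g θ < 0`.
    set φ : ℝ → ℝ := fun x => max (-x) 0 / (1 + |x|) with hφ
    have hφc : Continuous φ := by
      apply Continuous.div (by fun_prop) (by fun_prop)
      intro x; positivity
    have hφ0 : ∀ x, 0 ≤ φ x := fun x => by positivity
    have hφ1 : ∀ x, φ x ≤ 1 := fun x => by
      rw [hφ]; simp only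
      rw [div_le_one (by positivity)]
      exact max_le (by linarith [neg_abs_le x]) (by positivity)
    have hgm : AEStronglyMeasurable g circleHaar := by
      have hc : Continuous fun A : Matrix n n ℂ => (star v ⬝ᵥ A *ᵥ v).re :=
        Complex.continuous_re.comp
          (Continuous.dotProduct continuous_const (continuous_id.matrix_mulVec continuous_const))
      exact hc.comp_aestronglyMeasurable hX.aestronglyMeasurable
    have hhm : AEStronglyMeasurable (fun θ => φ (g θ)) circleHaar :=
      hφc.comp_aestronglyMeasurable hgm
    have hhm' : AEStronglyMeasurable (fun θ => φ (g (-θ))) circleHaar :=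
      hhm.comp_measurePreserving (Measure.measurePreserving_neg circleHaar)
    set V := vecMulVec v (star v) with hV
    have hVpos : V.PosSemidef := posSemidef_vecMulVec_self_star v
    have hVpos' : (V.map (starRingEnd ℂ)).PosSemidef := by
      rw [map_conj_eq, hVpos.isHermitian.eq]; exact hVpos.transpose
    -- The reflected second term makes the test symbol that of a real operator. By the symmetry of
    -- `X` it contributes `u (-θ)`, which has the same sign as `u θ`.
    set H : ToeplitzSymbol n n := fun θ =>
      ((φ (g θ) : ℝ) : ℂ) • V + ((φ (g (-θ)) : ℝ) : ℂ) • V.map (starRingEnd ℂ) with hHdef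
    have hHb : IsLinf H := by
      refine IsLinf.add (X := fun θ => ((φ (g θ) : ℝ) : ℂ) • V)
        (Y := fun θ => ((φ (g (-θ)) : ℝ) : ℂ) • V.map (starRingEnd ℂ))
        (isLinf_smul hhm (fun θ => ?_) V) (isLinf_smul hhm' (fun θ => ?_) _) <;>
      exact (abs_of_nonneg (hφ0 _)).trans_le (hφ1 _)
    have hHs : IsConjSymm H := Eventually.of_forall fun θ => by
      simp only [hHdef, neg_neg]
      rw [map_conj_add, map_conj_smul_real, map_conj_smul_real, add_comm]
      congr 2
      ext; simp
    have hHp : ∀ θ, (H θ).PosSemidef := fun θ =>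
      (hVpos.smul_ofReal (hφ0 _)).add (hVpos'.smul_ofReal (hφ0 _))
    have h0 := h H hHb hHs hHp
    set u : UnitAddCircle → ℝ := fun θ => φ (g θ) * g θ with hu
    have hu0 : ∀ θ, u θ ≤ 0 := fun θ => by
      simp only [hu, hφ]
      rcases le_total (g θ) 0 with hle | hle
      · exact mul_nonpos_of_nonneg_of_nonpos (hφ0 _) hle
      · simp [hle]
    have hae : ∀ᵐ θ ∂circleHaar, (X θ * H θ).trace.re = u θ + u (-θ) := by
      filter_upwards [ae_neg hsymm] with θ hθ
      rw [neg_neg] at hθ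
      have h2 : (X θ * V.map (starRingEnd ℂ)).trace.re = g (-θ) := by
        rw [hθ, ← map_conj_mul, trace_map_conj, Complex.conj_re, htr]
      simp only [hHdef]
      rw [mul_add, mul_smul_comm, mul_smul_comm, trace_add, trace_smul, trace_smul, smul_eq_mul,
        smul_eq_mul, Complex.add_re, Complex.re_ofReal_mul, Complex.re_ofReal_mul, htr, h2]
    have hint : Integrable (fun θ => u θ + u (-θ)) circleHaar :=
      (hX.mul hHb).re_trace.congr hae
    rw [integral_congr_ae hae] at h0
    have hw0 : ∀ θ, 0 ≤ -(u θ + u (-θ)) := fun θ => by linarith [hu0 θ, hu0 (-θ)]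
    have hz : (fun θ => -(u θ + u (-θ))) =ᵐ[circleHaar] 0 := by
      refine (integral_eq_zero_iff_of_nonneg hw0 hint.neg).1 (le_antisymm ?_ (integral_nonneg hw0))
      rw [integral_neg]
      linarith
    filter_upwards [hz] with θ hθ
    by_contra! hneg
    simp only [Pi.zero_apply] at hθ
    have h4 : u θ < 0 := by
      refine mul_neg_of_pos_of_neg (div_pos ?_ (by positivity)) hneg
      exact lt_max_of_lt_left (by linarith)
    linarith [hu0 (-θ)]
  -- The null set in `key` depends on `v`; a countable dense family of vectors and continuity of the
  -- quadratic form give one null set for all.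
  filter_upwards [hH, ae_all_iff.2 fun k => key (TopologicalSpace.denseSeq (n → ℂ) k)]
    with θ hθ hk
  refine PosSemidef.of_dotProduct_mulVec_nonneg hθ fun x => ?_
  refine Complex.nonneg_iff.2 ⟨?_, (hθ.im_star_dotProduct_mulVec_self x).symm⟩
  have hcl : IsClosed {x : n → ℂ | 0 ≤ (star x ⬝ᵥ X θ *ᵥ x).re} := by
    refine isClosed_le continuous_const (Complex.continuous_re.comp ?_)
    exact Continuous.dotProduct continuous_star (continuous_const.matrix_mulVec continuous_id)
  have hd := TopologicalSpace.denseRange_denseSeq (n → ℂ)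
  exact hd.induction_on (p := fun x => 0 ≤ (star x ⬝ᵥ X θ *ᵥ x).re) x hcl hk

end Integration

/-! ### The Hardy space as a closed subspace of `L²` -/

section Hardy

open Matrix Filter Topology

variable {m n : Type} [Fintype m] [Fintype n]

lemma block_combination {X Y : ToeplitzSymbol m n} (hX : IsL1 X) (hY : IsL1 Y) (a b : ℂ) (k : ℤ) :
    block (fun θ => a • X θ + b • Y θ) k = a • block X k + b • block Y k := by
  ext i j
  have h := congrFun (fourierCoeff.add ((hX i j).const_mul a) ((hY i j).const_mul b)) (-k)
  rw [Pi.add_apply] at h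
  refine h.trans ?_
  rw [fourierCoeff.const_mul, fourierCoeff.const_mul]
  rfl

lemma IsRealOp.combination {X Y : ToeplitzSymbol m n} (hX : IsRealOp X) (hY : IsRealOp Y)
    (hX' : IsL1 X) (hY' : IsL1 Y) (a b : ℝ) :
    IsRealOp fun θ => (a : ℂ) • X θ + (b : ℂ) • Y θ := fun k i j => by
  rw [block_combination hX' hY']
  simp [Matrix.add_apply, Matrix.smul_apply, hX k i j, hY k i j]

lemma IsHardy2.isL2 {X : ToeplitzSymbol m n} (hX : IsHardy2 X) : IsL2 X := hX.1

lemma IsHardy2.isConjSymm {X : ToeplitzSymbol m n} (hX : IsHardy2 X) : IsConjSymm X :=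
  hX.2.1.isConjSymm hX.1

lemma IsHardy2.combination {X Y : ToeplitzSymbol m n} (hX : IsHardy2 X) (hY : IsHardy2 Y)
    (a b : ℝ) : IsHardy2 fun θ => (a : ℂ) • X θ + (b : ℂ) • Y θ := by
  refine ⟨(hX.isL2.smul a).add (hY.isL2.smul b),
    hX.2.1.combination hY.2.1 hX.isL2.isL1 hY.isL2.isL1 a b, fun k hk => ?_⟩
  rw [block_combination hX.isL2.isL1 hY.isL2.isL1, hX.2.2 k hk, hY.2.2 k hk]
  simp

/-- The entries of a square integrable symbol as elements of `L²`. -/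
def toL2 (X : ToeplitzSymbol m n) : m → n → Lp ℂ 2 circleHaar := fun i j => by
  classical exact if h : MemLp (fun θ => X θ i j) 2 circleHaar then h.toLp else 0

lemma IsL2.coeFn_toL2 {X : ToeplitzSymbol m n} (hX : IsL2 X) (i : m) (j : n) :
    toL2 X i j =ᵐ[circleHaar] fun θ => X θ i j := by
  rw [toL2, dif_pos (hX i j)]
  exact (hX i j).coeFn_toLp

lemma IsL2.fourierCoeff_eq {X : ToeplitzSymbol m n} (hX : IsL2 X) (i : m) (j : n) (k : ℤ) :
    block X k i j = fourierBasis.repr (toL2 X i j) (-k) := by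
  rw [fourierBasis_repr, fourierCoeff_congr_ae (hX.coeFn_toL2 i j)]
  rfl

/-- Fourier coefficients are continuous on `L²`, and reality and causality are closed conditions on
them. -/
lemma isHardy2_of_tendsto {u : ℕ → ToeplitzSymbol m n} {X : ToeplitzSymbol m n}
    (hu : ∀ k, IsHardy2 (u k)) (hX : IsL2 X)
    (h : Tendsto (fun k => toL2 (u k)) atTop (𝓝 (toL2 X))) : IsHardy2 X := by
  have hc : ∀ (k : ℤ) (i : m) (j : n),
      Tendsto (fun N => block (u N) k i j) atTop (𝓝 (block X k i j)) := by
    intro k i j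
    have h1 : Tendsto (fun N => toL2 (u N) i j) atTop (𝓝 (toL2 X i j)) :=
      tendsto_pi_nhds.1 (tendsto_pi_nhds.1 h i) j
    simp only [(hu _).isL2.fourierCoeff_eq, hX.fourierCoeff_eq, HilbertBasis.repr_apply_apply]
    exact Tendsto.inner tendsto_const_nhds h1
  refine ⟨hX, fun k i j => ?_, fun k hk => ?_⟩
  · have h1 := (Complex.continuous_im.tendsto _).comp (hc k i j)
    refine tendsto_nhds_unique h1 ?_
    simp only [Function.comp_def, (hu _).2.1 k i j]
    exact tendsto_const_nhds
  · ext i j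
    refine tendsto_nhds_unique (hc k i j) ?_
    simp only [(hu _).2.2 k hk]
    exact tendsto_const_nhds

lemma exists_seq_forall_tendsto_ae {ι : Type*} (s : Finset ι) {α : Type*} [MeasurableSpace α]
    {μ : Measure α} {f : ι → ℕ → α → ℂ} {g : ι → α → ℂ}
    (h : ∀ i ∈ s, TendstoInMeasure μ (f i) atTop (g i)) :
    ∃ ns : ℕ → ℕ, StrictMono ns ∧
      ∀ i ∈ s, ∀ᵐ x ∂μ, Tendsto (fun k => f i (ns k) x) atTop (𝓝 (g i x)) := by
  classical
  induction s using Finset.induction_on with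
  | empty => exact ⟨id, strictMono_id, by simp⟩
  | insert a s _ ih =>
    obtain ⟨ns, hns, h1⟩ := ih fun i hi => h i (Finset.mem_insert_of_mem hi)
    have h2 : TendstoInMeasure μ (fun k => f a (ns k)) atTop (g a) :=
      fun ε hε => (h a (Finset.mem_insert_self a s) ε hε).comp hns.tendsto_atTop
    obtain ⟨ms, hms, h3⟩ := h2.exists_seq_tendsto_ae
    refine ⟨ns ∘ ms, hns.comp hms, fun i hi => ?_⟩
    rcases Finset.mem_insert.1 hi with rfl | hi
    · exact h3
    · exact (h1 i hi).mono fun x hx => hx.comp hms.tendsto_atTop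

lemma sum_integral_norm_sq_eq {X : ToeplitzSymbol m n} (hX : IsL2 X) :
    ∫ θ, ((X θ)ᴴ * X θ).trace.re ∂circleHaar = ∑ j, ∑ i, ‖toL2 X i j‖ ^ 2 := by
  simp only [re_trace_conjTranspose_mul_self]
  have hi : ∀ i j, Integrable (fun θ => ‖X θ i j‖ ^ 2) circleHaar := fun i j =>
    (memLp_two_iff_integrable_sq_norm (hX i j).1).1 (hX i j)
  rw [integral_finsetSum _ fun j _ => integrable_finsetSum _ fun i _ => hi i j]
  refine Finset.sum_congr rfl fun j _ => ?_
  rw [integral_finsetSum _ fun i _ => hi i j]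
  refine Finset.sum_congr rfl fun i _ => ?_
  have hcongr : ∫ θ, ‖X θ i j‖ ^ 2 ∂circleHaar = ∫ θ, ‖toL2 X i j θ‖ ^ 2 ∂circleHaar :=
    integral_congr_ae ((hX.coeFn_toL2 i j).mono fun θ hθ => congrArg (‖·‖ ^ 2) hθ.symm)
  rw [hcongr]
  have h1 := inner_self_eq_norm_sq_to_K (𝕜 := ℂ) (toL2 X i j)
  rw [L2.inner_def] at h1
  simp only [inner_self_eq_norm_sq_to_K] at h1
  have h2 : ((∫ θ, ‖toL2 X i j θ‖ ^ 2 ∂circleHaar : ℝ) : ℂ) = ((‖toL2 X i j‖ ^ 2 : ℝ) : ℂ) := by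
    rw [← integral_complex_ofReal]
    push_cast
    exact h1
  exact_mod_cast h2

lemma toL2_sub {X Y : ToeplitzSymbol m n} (hX : IsL2 X) (hY : IsL2 Y) :
    toL2 (fun θ => X θ - Y θ) = toL2 X - toL2 Y := by
  funext i j
  have h := hX.sub hY i j
  simp only [Pi.sub_apply]
  rw [toL2, toL2, toL2, dif_pos h, dif_pos (hX i j), dif_pos (hY i j)]
  exact MemLp.toLp_sub (hX i j) (hY i j)

/-- The norm of `toL2 X` is the maximum over entries, so it is below the Hilbert–Schmidt norm; the
reverse comparison costs the number of entries. -/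
lemma norm_toL2_sq_le {X : ToeplitzSymbol m n} (hX : IsL2 X) :
    ‖toL2 X‖ ^ 2 ≤ ∫ θ, ((X θ)ᴴ * X θ).trace.re ∂circleHaar := by
  rw [sum_integral_norm_sq_eq hX]
  have h0 : 0 ≤ ∑ j, ∑ i, ‖toL2 X i j‖ ^ 2 := by positivity
  rw [← Real.sq_sqrt h0]
  refine pow_le_pow_left₀ (norm_nonneg _) ?_ 2
  refine (pi_norm_le_iff_of_nonneg (Real.sqrt_nonneg _)).2 fun i =>
    (pi_norm_le_iff_of_nonneg (Real.sqrt_nonneg _)).2 fun j => Real.le_sqrt_of_sq_le ?_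
  refine le_trans ?_ (Finset.single_le_sum (f := fun j => ∑ i, ‖toL2 X i j‖ ^ 2)
    (fun k _ => by positivity) (Finset.mem_univ j))
  exact Finset.single_le_sum (f := fun i => ‖toL2 X i j‖ ^ 2)
    (fun k _ => by positivity) (Finset.mem_univ i)

lemma integral_le_norm_toL2_sq {X : ToeplitzSymbol m n} (hX : IsL2 X) :
    ∫ θ, ((X θ)ᴴ * X θ).trace.re ∂circleHaar ≤
      Fintype.card n * Fintype.card m * ‖toL2 X‖ ^ 2 := by
  rw [sum_integral_norm_sq_eq hX]
  calc _ ≤ ∑ _j : n, ∑ _i : m, ‖toL2 X‖ ^ 2 := by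
        gcongr with j _ i _
        exact (norm_le_pi_norm (toL2 X i) j).trans (norm_le_pi_norm (toL2 X) i)
    _ = _ := by simp; ring

end Hardy

/-! ### The regret operator and the causal controllers -/

namespace LTISystem

open Matrix Filter Topology

variable {n d p : ℕ} (S : LTISystem n d p)

lemma closedLoop_conjTranspose_mul_self (K : ToeplitzSymbol (Fin d) (Fin p)) (θ : UnitAddCircle) :
    (S.closedLoop K θ)ᴴ * S.closedLoop K θ =
      (S.F θ * K θ + S.G θ)ᴴ * (S.F θ * K θ + S.G θ) + (K θ)ᴴ * K θ := by
  rw [closedLoop, conjTranspose_fromRows_eq_fromCols_conjTranspose, fromCols_mul_fromRows]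

/-- Completion of squares. -/
lemma regretOp_eq (K : ToeplitzSymbol (Fin d) (Fin p)) (θ : UnitAddCircle) :
    S.regretOp K θ = (K θ - S.noncausalOpt θ)ᴴ * (1 + (S.F θ)ᴴ * S.F θ) *
      (K θ - S.noncausalOpt θ) := by
  set R := 1 + (S.F θ)ᴴ * S.F θ with hR
  have hRpos : R.PosDef := PosDef.one.add_posSemidef (posSemidef_conjTranspose_mul_self _)
  have hdet : IsUnit R.det := (isUnit_iff_isUnit_det _).1 hRpos.isUnit
  have h1 : (S.F θ)ᴴ * S.G θ = -(R * S.noncausalOpt θ) := by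
    rw [noncausalOpt, Matrix.mul_neg, neg_neg, ← hR, Matrix.mul_assoc R⁻¹,
      mul_nonsing_inv_cancel_left _ _ hdet]
  have h2 : (S.G θ)ᴴ * S.F θ = -((S.noncausalOpt θ)ᴴ * R) := by
    have := congrArg conjTranspose h1
    rwa [conjTranspose_mul, conjTranspose_conjTranspose, conjTranspose_neg, conjTranspose_mul,
      hRpos.isHermitian.eq] at this
  -- Holding for every `L`, this is used for both `K` and `noncausalOpt`; the common term `Gᴴ G`
  -- cancels in the difference.
  have h3 : ∀ L : ToeplitzSymbol (Fin d) (Fin p), (S.closedLoop L θ)ᴴ * S.closedLoop L θ =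
      (L θ)ᴴ * R * L θ - (L θ)ᴴ * R * S.noncausalOpt θ - (S.noncausalOpt θ)ᴴ * R * L θ +
        (S.G θ)ᴴ * S.G θ := by
    intro L
    rw [closedLoop_conjTranspose_mul_self, conjTranspose_add, conjTranspose_mul]
    have e1 : (L θ)ᴴ * R * S.noncausalOpt θ = -((L θ)ᴴ * (S.F θ)ᴴ * S.G θ) := by
      rw [Matrix.mul_assoc, Matrix.mul_assoc (L θ)ᴴ, h1, Matrix.mul_neg, neg_neg]
    have e2 : (S.noncausalOpt θ)ᴴ * R * L θ = -((S.G θ)ᴴ * (S.F θ * L θ)) := by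
      rw [← Matrix.mul_assoc, h2, Matrix.neg_mul, neg_neg]
    rw [e1, e2, hR]
    simp only [Matrix.add_mul, Matrix.mul_add, Matrix.mul_one, Matrix.mul_assoc]
    abel
  rw [regretOp, h3, h3]
  simp only [conjTranspose_sub, Matrix.sub_mul, Matrix.mul_sub]
  abel

lemma regretOp_posSemidef (K : ToeplitzSymbol (Fin d) (Fin p)) (θ : UnitAddCircle) :
    (S.regretOp K θ).PosSemidef := by
  rw [regretOp_eq]
  exact ((PosDef.one.add_posSemidef
    (posSemidef_conjTranspose_mul_self _)).posSemidef).conjTranspose_mul_mul_same _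

/-- The affine combination `(1 - t) K + t K'` of two controllers. -/
def comb (K K' : ToeplitzSymbol (Fin d) (Fin p)) (t : ℝ) : ToeplitzSymbol (Fin d) (Fin p) :=
  fun θ => ((1 - t : ℝ) : ℂ) • K θ + (t : ℂ) • K' θ

lemma closedLoop_comb (K K' : ToeplitzSymbol (Fin d) (Fin p)) (t : ℝ) :
    S.closedLoop (comb K K' t) =
      fun θ => ((1 - t : ℝ) : ℂ) • S.closedLoop K θ + (t : ℂ) • S.closedLoop K' θ := by
  funext θ
  ext i j
  rcases i with i | i
  · have h : S.G θ i j = ((1 - t : ℝ) : ℂ) * S.G θ i j + (t : ℂ) * S.G θ i j := by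
      push_cast; ring
    simp only [closedLoop, comb, fromRows_apply_inl, Matrix.add_apply, Matrix.smul_apply,
      Matrix.mul_add, Matrix.mul_smul, smul_eq_mul]
    rw [h]; push_cast; ring
  · simp only [closedLoop, comb, fromRows_apply_inr, Matrix.add_apply, Matrix.smul_apply]

lemma comb_mem_causal {K K' : ToeplitzSymbol (Fin d) (Fin p)} (hK : K ∈ S.causal)
    (hK' : K' ∈ S.causal) (t : ℝ) : comb K K' t ∈ S.causal := by
  refine ⟨hK.1.combination hK'.1 _ _, ?_⟩
  rw [closedLoop_comb]
  exact hK.2.combination hK'.2 _ _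

/-- The closed loop is affine in the controller, and the `K∘` term drops out of the defect because
the weights sum to one. -/
lemma regretOp_comb (K K' : ToeplitzSymbol (Fin d) (Fin p)) (t : ℝ) (θ : UnitAddCircle) :
    S.regretOp (comb K K' t) θ = ((1 - t : ℝ) : ℂ) • S.regretOp K θ + (t : ℂ) • S.regretOp K' θ -
      ((t * (1 - t) : ℝ) : ℂ) • ((S.closedLoop K' θ - S.closedLoop K θ)ᴴ *
        (S.closedLoop K' θ - S.closedLoop K θ)) := by
  simp only [regretOp, closedLoop_comb]
  generalize S.closedLoop K θ = A
  generalize S.closedLoop K' θ = B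
  simp only [conjTranspose_add, conjTranspose_smul, conjTranspose_sub, Matrix.add_mul,
    Matrix.mul_add, Matrix.sub_mul, Matrix.mul_sub, Matrix.smul_mul, Matrix.mul_smul,
    Complex.star_def, Complex.conj_ofReal]
  ext i j
  simp only [Matrix.add_apply, Matrix.sub_apply, Matrix.smul_apply, smul_eq_mul]
  push_cast
  ring

lemma aestronglyMeasurable_resolvent : AEStronglyMeasurable S.resolvent circleHaar := by
  refine aestronglyMeasurable_inv ?_
  have : Continuous fun θ : UnitAddCircle =>
      zvar θ • (1 : Matrix (Fin n) (Fin n) ℂ) - S.A.map ((↑) : ℝ → ℂ) :=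
    ((fourier 1).continuous.smul continuous_const).sub continuous_const
  exact this.aestronglyMeasurable

lemma aestronglyMeasurable_F : AEStronglyMeasurable S.F circleHaar :=
  aestronglyMeasurable_matrix_mul S.aestronglyMeasurable_resolvent aestronglyMeasurable_const

lemma aestronglyMeasurable_G : AEStronglyMeasurable S.G circleHaar :=
  AEStronglyMeasurable.smul (fourier 1).continuous.aestronglyMeasurable
    (aestronglyMeasurable_matrix_mul S.aestronglyMeasurable_resolvent aestronglyMeasurable_const)

lemma aestronglyMeasurable_noncausalOpt : AEStronglyMeasurable S.noncausalOpt circleHaar := by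
  have hF := aestronglyMeasurable_conjTranspose S.aestronglyMeasurable_F
  exact (aestronglyMeasurable_matrix_mul (aestronglyMeasurable_matrix_mul
    (aestronglyMeasurable_inv (aestronglyMeasurable_const.add
      (aestronglyMeasurable_matrix_mul hF S.aestronglyMeasurable_F))) hF)
    S.aestronglyMeasurable_G).neg

lemma aestronglyMeasurable_closedLoop {K : ToeplitzSymbol (Fin d) (Fin p)}
    (hK : AEStronglyMeasurable K circleHaar) :
    AEStronglyMeasurable (S.closedLoop K) circleHaar := by
  have h := (aestronglyMeasurable_matrix_mul S.aestronglyMeasurable_F hK).add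
    S.aestronglyMeasurable_G
  refine aestronglyMeasurable_of_apply fun i j => ?_
  rcases i with i | i
  · exact aestronglyMeasurable_apply h i j
  · exact aestronglyMeasurable_apply hK i j

/-- `F` and `G` may have poles on the circle; square integrability comes from `C_K ≥ 0`, which
bounds the noncausal closed loop by that of `K`. -/
lemma isL2_closedLoop_noncausalOpt {K : ToeplitzSymbol (Fin d) (Fin p)} (hK : K ∈ S.causal) :
    IsL2 (S.closedLoop S.noncausalOpt) :=
  isL2_of_conjTranspose_mul_self_le
    (S.aestronglyMeasurable_closedLoop S.aestronglyMeasurable_noncausalOpt) hK.2.isL2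
    (Eventually.of_forall fun θ => S.regretOp_posSemidef K θ)

lemma isL1_regretOp {K : ToeplitzSymbol (Fin d) (Fin p)} (hK : K ∈ S.causal) :
    IsL1 (S.regretOp K) :=
  (hK.2.isL2.conjTranspose.mul hK.2.isL2).sub
    ((S.isL2_closedLoop_noncausalOpt hK).conjTranspose.mul (S.isL2_closedLoop_noncausalOpt hK))

lemma zvar_neg (θ : UnitAddCircle) : zvar (-θ) = starRingEnd ℂ (zvar θ) := by
  rw [zvar, zvar, ← fourier_neg]
  simp [fourier_apply]

lemma map_conj_smul {m n : Type} (c : ℂ) (A : Matrix m n ℂ) :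
    (c • A).map (starRingEnd ℂ) = starRingEnd ℂ c • A.map (starRingEnd ℂ) := by
  ext; simp

lemma resolvent_neg (θ : UnitAddCircle) :
    S.resolvent (-θ) = (S.resolvent θ).map (starRingEnd ℂ) := by
  rw [resolvent, resolvent, map_conj_inv, map_conj_sub, map_conj_smul, map_conj_one,
    map_conj_map_ofReal, zvar_neg]

lemma F_neg (θ : UnitAddCircle) : S.F (-θ) = (S.F θ).map (starRingEnd ℂ) := by
  rw [F, F, map_conj_mul, map_conj_map_ofReal, resolvent_neg]

lemma G_neg (θ : UnitAddCircle) : S.G (-θ) = (S.G θ).map (starRingEnd ℂ) := by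
  rw [G, G, map_conj_smul, map_conj_mul, map_conj_map_ofReal, resolvent_neg, zvar_neg]

lemma closedLoop_neg {K : ToeplitzSymbol (Fin d) (Fin p)} {θ : UnitAddCircle}
    (h : K (-θ) = (K θ).map (starRingEnd ℂ)) :
    S.closedLoop K (-θ) = (S.closedLoop K θ).map (starRingEnd ℂ) := by
  have h1 : S.F (-θ) * K (-θ) + S.G (-θ) = (S.F θ * K θ + S.G θ).map (starRingEnd ℂ) := by
    rw [F_neg, G_neg, h, map_conj_add, map_conj_mul]
  ext i j
  rcases i with i | i
  · simp only [closedLoop, fromRows_apply_inl, h1, Matrix.map_apply]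
  · simp only [closedLoop, fromRows_apply_inr, h, Matrix.map_apply]

lemma noncausalOpt_neg (θ : UnitAddCircle) :
    S.noncausalOpt (-θ) = (S.noncausalOpt θ).map (starRingEnd ℂ) := by
  have hn : ∀ A : Matrix (Fin d) (Fin p) ℂ,
      (-A).map (starRingEnd ℂ) = -A.map (starRingEnd ℂ) := fun A => by ext; simp
  rw [noncausalOpt, noncausalOpt, F_neg, G_neg, hn, map_conj_mul, map_conj_mul, map_conj_inv,
    map_conj_add, map_conj_mul, map_conj_conjTranspose, map_conj_one]

lemma isConjSymm_regretOp {K : ToeplitzSymbol (Fin d) (Fin p)} (hK : K ∈ S.causal) :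
    IsConjSymm (S.regretOp K) := by
  filter_upwards [hK.1.isConjSymm] with θ hθ
  rw [regretOp, regretOp, S.closedLoop_neg hθ, S.closedLoop_neg (S.noncausalOpt_neg θ),
    map_conj_sub, map_conj_mul, map_conj_mul, map_conj_conjTranspose, map_conj_conjTranspose]

/-- The closed loops of the causal controllers form a closed subset of `L²`. -/
lemma exists_causal_tendsto {u : ℕ → ToeplitzSymbol (Fin d) (Fin p)} (hu : ∀ k, u k ∈ S.causal)
    (hc : CauchySeq fun k => toL2 (S.closedLoop (u k))) :
    ∃ K ∈ S.causal, Tendsto (fun k => toL2 (S.closedLoop (u k))) atTop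
      (𝓝 (toL2 (S.closedLoop K))) := by
  obtain ⟨e, he⟩ := cauchySeq_tendsto_of_complete hc
  have he' : ∀ i j, Tendsto (fun k => toL2 (S.closedLoop (u k)) i j) atTop (𝓝 (e i j)) :=
    fun i j => tendsto_pi_nhds.1 (tendsto_pi_nhds.1 he i) j
  -- The limit controller is the lower block of the limit closed loop.
  set K : ToeplitzSymbol (Fin d) (Fin p) := fun θ => of fun a b => e (Sum.inr a) b θ with hK
  obtain ⟨ns, -, hns⟩ := exists_seq_forall_tendsto_ae Finset.univ
    (f := fun (ij : (Fin n ⊕ Fin d) × Fin p) k => toL2 (S.closedLoop (u k)) ij.1 ij.2)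
    (g := fun ij => e ij.1 ij.2)
    fun ij _ => tendstoInMeasure_of_tendsto_Lp (he' ij.1 ij.2)
  have hns' : ∀ᵐ θ ∂circleHaar, ∀ i j,
      Tendsto (fun k => S.closedLoop (u (ns k)) θ i j) atTop (𝓝 (e i j θ)) := by
    refine ae_all_iff.2 fun i => ae_all_iff.2 fun j => ?_
    filter_upwards [hns (i, j) (Finset.mem_univ _),
      ae_all_iff.2 fun k => (hu (ns k)).2.isL2.coeFn_toL2 i j] with θ h1 h2
    exact h1.congr h2
  -- The upper block is identified pointwise along the subsequence: at fixed `θ` the map `A ↦ F θ *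
  -- A + G θ` is continuous, so unbounded `F` does no harm.
  have hT : ∀ᵐ θ ∂circleHaar, ∀ i j, S.closedLoop K θ i j = e i j θ := by
    filter_upwards [hns'] with θ hθ i j
    rcases i with i | i
    · have h1 : Tendsto (fun k => u (ns k) θ) atTop (𝓝 (K θ)) :=
        tendsto_pi_nhds.2 fun a => tendsto_pi_nhds.2 fun b => hθ (Sum.inr a) b
      have hcont : Continuous fun A : Matrix (Fin d) (Fin p) ℂ => (S.F θ * A + S.G θ) i j :=
        ((continuous_const.matrix_mul continuous_id).add continuous_const).matrix_elem i j
      exact tendsto_nhds_unique ((hcont.tendsto _).comp h1) (hθ (Sum.inl i) j)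
    · rfl
  have hT2 : IsL2 (S.closedLoop K) := fun i j =>
    (Lp.memLp (e i j)).ae_eq (hT.mono fun θ h => (h i j).symm)
  have hTe : toL2 (S.closedLoop K) = e := by
    funext i j
    exact Lp.ext ((hT2.coeFn_toL2 i j).trans (hT.mono fun θ h => h i j))
  rw [← hTe] at he
  have hH := isHardy2_of_tendsto (fun k => (hu k).2) hT2 he
  refine ⟨K, ⟨⟨fun i j => hT2 (Sum.inr i) j, fun k i j => hH.2.1 k (Sum.inr i) j,
    fun k hk => ?_⟩, hH⟩, he⟩
  ext i j
  exact congrFun (congrFun (hH.2.2 k hk) (Sum.inr i)) j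

end LTISystem

/-! ### The payoff and its minimax problem -/

namespace LTISystem

open Matrix Filter Topology

variable {n d p : ℕ} (S : LTISystem n d p)

/-- The payoff `-Tr M + 2 Tr √M + γ⁻¹ Tr (C_K M)` of the minimax problem. -/
def payoff (γ : ℝ) (K : ToeplitzSymbol (Fin d) (Fin p)) (M : ToeplitzSymbol (Fin p) (Fin p)) : ℝ :=
  -normTrace M + 2 * normTrace (sqrtOp M) + γ⁻¹ * normTrace (S.regretOp K * M)

/-- The real bounded operators `M` with `M ≥ I`. -/
def geOne (p : ℕ) : Set (ToeplitzSymbol (Fin p) (Fin p)) :=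
  {M | IsBoundedOp M ∧ ∀ᵐ θ ∂circleHaar, (M θ - 1).PosSemidef}

lemma posDef_of_sub_one_posSemidef {A : Matrix (Fin p) (Fin p) ℂ} (h : (A - 1).PosSemidef) :
    A.PosDef := posDef_of_sub_smul_one (ε := 1) one_pos (by simpa using h)

lemma ae_posSemidef_of_isPosDefOp {M : ToeplitzSymbol (Fin p) (Fin p)} (hM : IsPosDefOp M) :
    ∀ᵐ θ ∂circleHaar, (M θ).PosSemidef := by
  obtain ⟨ε, hε, h⟩ := hM
  exact h.mono fun θ hθ => (posDef_of_sub_smul_one hε hθ).posSemidef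

lemma isPosDefOp_of_geOne {M : ToeplitzSymbol (Fin p) (Fin p)} (hM : M ∈ geOne p) :
    IsPosDefOp M := ⟨1, one_pos, hM.2.mono fun θ hθ => by simpa using hθ⟩

variable {S} {γ : ℝ} {K K' : ToeplitzSymbol (Fin d) (Fin p)} {M : ToeplitzSymbol (Fin p) (Fin p)}

lemma integrable_payoff (hK : K ∈ S.causal) (hM : IsLinf M)
    (hpos : ∀ᵐ θ ∂circleHaar, (M θ).PosSemidef) :
    Integrable (fun θ => -(M θ).trace.re + 2 * (CFC.sqrt (M θ)).trace.re +
      γ⁻¹ * (S.regretOp K θ * M θ).trace.re) circleHaar :=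
  (hM.isL2.isL1.re_trace.neg.add ((hM.isL2.isL1.sqrtOp hpos).isL1.re_trace.const_mul 2)).add
    (((S.isL1_regretOp hK).mul hM).re_trace.const_mul γ⁻¹)

lemma payoff_eq_integral (hK : K ∈ S.causal) (hM : IsLinf M)
    (hpos : ∀ᵐ θ ∂circleHaar, (M θ).PosSemidef) :
    S.payoff γ K M = ∫ θ, (-(M θ).trace.re + 2 * (CFC.sqrt (M θ)).trace.re +
      γ⁻¹ * (S.regretOp K θ * M θ).trace.re) ∂circleHaar := by
  have h1 := hM.isL2.isL1
  have h2 := (hM.isL2.isL1.sqrtOp hpos).isL1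
  have h3 := (S.isL1_regretOp hK).mul hM
  have i1 : Integrable (fun θ => -(M θ).trace.re) circleHaar := h1.re_trace.neg
  have i2 : Integrable (fun θ => 2 * (CFC.sqrt (M θ)).trace.re) circleHaar :=
    h2.re_trace.const_mul 2
  have i12 : Integrable (fun θ => -(M θ).trace.re + 2 * (CFC.sqrt (M θ)).trace.re) circleHaar :=
    i1.add i2
  rw [integral_add i12 (h3.re_trace.const_mul γ⁻¹), integral_add i1 i2, integral_neg,
    integral_const_mul, integral_const_mul, payoff, h1.normTrace_eq, h2.normTrace_eq]
  rw [show S.regretOp K * M = fun θ => S.regretOp K θ * M θ from rfl, h3.normTrace_eq]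
  rfl

lemma integral_neg_trace_le_payoff (hγ : 0 < γ) (hK : K ∈ S.causal) (hM : IsLinf M)
    (hpos : ∀ᵐ θ ∂circleHaar, (M θ).PosSemidef) :
    ∫ θ, -(M θ).trace.re ∂circleHaar ≤ S.payoff γ K M := by
  rw [payoff_eq_integral hK hM hpos]
  refine integral_mono_ae hM.isL2.isL1.re_trace.neg (integrable_payoff hK hM hpos)
    (hpos.mono fun θ hθ => ?_)
  have h1 := (posSemidef_sqrt (M θ)).re_trace_nonneg
  have h2 := mul_nonneg (inv_nonneg.2 hγ.le) ((S.regretOp_posSemidef K θ).re_trace_mul_nonneg hθ)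
  simp only
  linarith

lemma payoff_comb (hK : K ∈ S.causal) (hK' : K' ∈ S.causal) (hM : IsLinf M)
    (hpos : ∀ᵐ θ ∂circleHaar, (M θ).PosSemidef) (t : ℝ) :
    S.payoff γ (comb K K' t) M = (1 - t) * S.payoff γ K M + t * S.payoff γ K' M - t * (1 - t) *
      (γ⁻¹ * ∫ θ, ((S.closedLoop K' θ - S.closedLoop K θ)ᴴ *
        (S.closedLoop K' θ - S.closedLoop K θ) * M θ).trace.re ∂circleHaar) := by
  have hD := hK'.2.isL2.sub hK.2.isL2
  have hq := ((hD.conjTranspose.mul hD).mul hM).re_trace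
  rw [payoff_eq_integral hK hM hpos, payoff_eq_integral hK' hM hpos,
    payoff_eq_integral (S.comb_mem_causal hK hK' t) hM hpos, ← mul_assoc, ← integral_const_mul,
    ← integral_const_mul, ← integral_const_mul,
    ← integral_add ((integrable_payoff hK hM hpos).const_mul _)
      ((integrable_payoff hK' hM hpos).const_mul _)]
  refine Eq.trans ?_ (integral_sub (((integrable_payoff hK hM hpos).const_mul (1 - t)).add
      ((integrable_payoff hK' hM hpos).const_mul t)) (hq.const_mul (t * (1 - t) * γ⁻¹)))
  refine integral_congr_ae (Eventually.of_forall fun θ => ?_)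
  simp only [regretOp_comb, Matrix.add_mul, Matrix.sub_mul, Matrix.smul_mul,
    trace_add, trace_sub,
    trace_smul, smul_eq_mul, Complex.add_re, Complex.sub_re, Complex.re_ofReal_mul]
  ring

lemma payoff_concave {M' : ToeplitzSymbol (Fin p) (Fin p)} (hK : K ∈ S.causal) (hM : M ∈ geOne p)
    (hM' : M' ∈ geOne p) {t : ℝ} (ht : t ∈ Set.Ioo (0 : ℝ) 1) :
    (1 - t) * S.payoff γ K M + t * S.payoff γ K M' ≤
      S.payoff γ K fun θ => ((1 - t : ℝ) : ℂ) • M θ + (t : ℂ) • M' θ := by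
  have hM₀ := hM.2.mono fun θ hθ => (posDef_of_sub_one_posSemidef hθ).posSemidef
  have hM₁ := hM'.2.mono fun θ hθ => (posDef_of_sub_one_posSemidef hθ).posSemidef
  have hM₂ : ∀ᵐ θ ∂circleHaar, (((1 - t : ℝ) : ℂ) • M θ + (t : ℂ) • M' θ).PosSemidef := by
    filter_upwards [hM₀, hM₁] with θ h h'
    exact (h.smul_ofReal (sub_nonneg.2 ht.2.le)).add (h'.smul_ofReal ht.1.le)
  have hb : IsLinf fun θ => ((1 - t : ℝ) : ℂ) • M θ + (t : ℂ) • M' θ :=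
    (IsLinf.smul hM.1.1 _).add (IsLinf.smul hM'.1.1 _)
  rw [payoff_eq_integral hK hM.1.1 hM₀, payoff_eq_integral hK hM'.1.1 hM₁,
    payoff_eq_integral hK hb hM₂, ← integral_const_mul, ← integral_const_mul,
    ← integral_add ((integrable_payoff hK hM.1.1 hM₀).const_mul _)
      ((integrable_payoff hK hM'.1.1 hM₁).const_mul _)]
  refine integral_mono_ae (((integrable_payoff hK hM.1.1 hM₀).const_mul _).add
      ((integrable_payoff hK hM'.1.1 hM₁).const_mul _)) (integrable_payoff hK hb hM₂) ?_
  filter_upwards [hM.2, hM'.2] with θ h h'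
  have := re_trace_sqrt_concave (posDef_of_sub_one_posSemidef h) (posDef_of_sub_one_posSemidef h') ht
  simp only [Matrix.mul_add, Matrix.mul_smul, trace_add, trace_smul, smul_eq_mul, Complex.add_re,
    Complex.re_ofReal_mul]
  linarith

lemma combination_mem_geOne {M' : ToeplitzSymbol (Fin p) (Fin p)} (hM : M ∈ geOne p)
    (hM' : M' ∈ geOne p) {t : ℝ} (ht : t ∈ Set.Ioo (0 : ℝ) 1) :
    (fun θ => ((1 - t : ℝ) : ℂ) • M θ + (t : ℂ) • M' θ) ∈ geOne p := by
  refine ⟨⟨(IsLinf.smul hM.1.1 _).add (IsLinf.smul hM'.1.1 _),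
    hM.1.2.combination hM'.1.2 (IsLinf.isL2 hM.1.1).isL1 (IsLinf.isL2 hM'.1.1).isL1 _ _⟩, ?_⟩
  filter_upwards [hM.2, hM'.2] with θ h h'
  convert (h.smul_ofReal (sub_nonneg.2 ht.2.le)).add (h'.smul_ofReal ht.1.le) using 1
  rw [smul_sub, smul_sub]
  have : (1 : Matrix (Fin p) (Fin p) ℂ) = ((1 - t : ℝ) : ℂ) • 1 + (t : ℂ) • 1 := by
    rw [← add_smul]; push_cast; simp
  nth_rewrite 1 [this]
  abel

/-- Existence of a controller that is optimal against every `M ≥ I`. -/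
theorem exists_causal_forall_payoff_le (hγ : 0 < γ) {v : ℝ}
    (hv : ∀ M ∈ geOne p, ∀ η > 0, ∃ K ∈ S.causal, S.payoff γ K M ≤ v + η)
    (hv' : ∀ η > 0, ∃ M ∈ geOne p, ∀ K ∈ S.causal, v - η ≤ S.payoff γ K M) :
    ∃ K ∈ S.causal, ∀ M ∈ geOne p, S.payoff γ K M ≤ v := by
  have hbd : ∀ M ∈ geOne p, ∃ c : ℝ, ∀ᵐ θ ∂circleHaar, ∀ i j, ‖M θ i j‖ ≤ c :=
    fun M hM => IsLinf.exists_bound hM.1.1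
  choose! c hc using hbd
  -- The restriction `M ≥ I` yields the modulus `γ⁻¹` uniformly in `M`; the upper constant may
  -- depend on `M` through its entry bound `c M`.
  refine exists_forall_le_of_quadratic (fun K => toL2 (S.closedLoop K)) (S.payoff γ) comb
    (fun M K K' => γ⁻¹ * ∫ θ, ((S.closedLoop K' θ - S.closedLoop K θ)ᴴ *
        (S.closedLoop K' θ - S.closedLoop K θ) * M θ).trace.re ∂circleHaar)
    (c := γ⁻¹) (v := v) (fun M => ∫ θ, -(M θ).trace.re ∂circleHaar)
    (fun M => γ⁻¹ * (Fintype.card (Fin p) ^ 2 * |c M| *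
      (Fintype.card (Fin p) * Fintype.card (Fin n ⊕ Fin d))))
    (inv_pos.2 hγ) (fun K hK K' hK' t => S.comb_mem_causal hK hK' t) ?_ ?_ ?_ ?_ ?_ ?_ hv hv'
  · exact fun M hM K hK K' hK' t => payoff_comb hK hK' hM.1.1
      (hM.2.mono fun θ hθ => (posDef_of_sub_one_posSemidef hθ).posSemidef) t
  · intro M hM K hK K' hK'
    have hD := hK'.2.isL2.sub hK.2.isL2
    rw [← toL2_sub hK'.2.isL2 hK.2.isL2]
    refine mul_le_mul_of_nonneg_left ((norm_toL2_sq_le hD).trans ?_) (inv_nonneg.2 hγ.le)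
    refine integral_mono_ae (hD.conjTranspose.mul hD).re_trace
      ((hD.conjTranspose.mul hD).mul hM.1.1).re_trace (hM.2.mono fun θ hθ => ?_)
    exact (posSemidef_conjTranspose_mul_self _).re_trace_le_re_trace_mul hθ
  · intro M hM K hK K' hK'
    have hD := hK'.2.isL2.sub hK.2.isL2
    rw [← toL2_sub hK'.2.isL2 hK.2.isL2, mul_assoc]
    refine mul_le_mul_of_nonneg_left ?_ (inv_nonneg.2 hγ.le)
    rw [mul_assoc]
    refine le_trans ?_ (mul_le_mul_of_nonneg_left (integral_le_norm_toL2_sq hD) (by positivity))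
    rw [← integral_const_mul]
    refine integral_mono_ae ((hD.conjTranspose.mul hD).mul hM.1.1).re_trace
      ((hD.conjTranspose.mul hD).re_trace.const_mul _) ((hc M hM).mono fun θ hθ => ?_)
    exact (posSemidef_conjTranspose_mul_self _).re_trace_mul_le
      fun i j => (hθ i j).trans (le_abs_self _)
  · exact fun M hM K hK => integral_neg_trace_le_payoff hγ hK hM.1.1
      (hM.2.mono fun θ hθ => (posDef_of_sub_one_posSemidef hθ).posSemidef)
  · exact fun M hM M' hM' t ht => ⟨_, combination_mem_geOne hM hM' ht,
      fun K hK => payoff_concave hK hM hM' ht⟩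
  · exact fun u hu hcs => S.exists_causal_tendsto hu hcs

/-! ### The slack operator and duality -/

/-- The operator `I - γ⁻¹ C_K`. -/
def slack (S : LTISystem n d p) (γ : ℝ) (K : ToeplitzSymbol (Fin d) (Fin p)) :
    ToeplitzSymbol (Fin p) (Fin p) :=
  1 - ((γ : ℂ)⁻¹) • S.regretOp K

lemma slack_apply (θ : UnitAddCircle) :
    S.slack γ K θ = 1 - ((γ⁻¹ : ℝ) : ℂ) • S.regretOp K θ := by
  rw [Complex.ofReal_inv]; rfl

lemma isL1_slack (hK : K ∈ S.causal) : IsL1 (S.slack γ K) :=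
  (isLinf_const 1).isL2.isL1.sub ((S.isL1_regretOp hK).smul _)

lemma isConjSymm_slack (hK : K ∈ S.causal) : IsConjSymm (S.slack γ K) := by
  filter_upwards [S.isConjSymm_regretOp hK] with θ hθ
  rw [slack_apply, slack_apply, hθ, map_conj_sub, map_conj_one, map_conj_smul_real]

lemma isHermitian_slack (θ : UnitAddCircle) : (S.slack γ K θ).IsHermitian := by
  rw [slack_apply]
  refine isHermitian_one.sub ?_
  rw [IsHermitian, conjTranspose_smul, (S.regretOp_posSemidef K θ).isHermitian.eq]
  simp

lemma one_sub_slack_posSemidef (hγ : 0 < γ) (θ : UnitAddCircle) :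
    (1 - S.slack γ K θ).PosSemidef := by
  rw [slack_apply, sub_sub_cancel]
  exact (S.regretOp_posSemidef K θ).smul_ofReal (inv_nonneg.2 hγ.le)

lemma isPosDefOp_slack_iff (hγ : 0 < γ) :
    IsPosDefOp (S.slack γ K) ↔ IsPosDefOp ((γ : ℂ) • 1 - S.regretOp K) := by
  have e : ∀ θ, S.slack γ K θ = ((γ⁻¹ : ℝ) : ℂ) • (((γ : ℂ) • 1 - S.regretOp K) θ) := by
    intro θ
    rw [slack_apply]
    simp only [Pi.sub_apply, Pi.smul_apply, Pi.one_apply, smul_sub, smul_smul]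
    simp [hγ.ne']
  have hγ' : (γ : ℂ) ≠ 0 := by exact_mod_cast hγ.ne'
  constructor
  · rintro ⟨ε, hε, h⟩
    refine ⟨γ * ε, by positivity, h.mono fun θ hθ => ?_⟩
    convert hθ.smul_ofReal hγ.le using 1
    rw [e, smul_sub, smul_smul, smul_smul]
    simp [hγ']
  · rintro ⟨ε, hε, h⟩
    refine ⟨γ⁻¹ * ε, by positivity, h.mono fun θ hθ => ?_⟩
    convert hθ.smul_ofReal (inv_nonneg.2 hγ.le) using 1
    rw [e, smul_sub, smul_smul]
    push_cast; rfl

lemma isLinf_inv_slack (hK : K ∈ S.causal) (hpos : IsPosDefOp (S.slack γ K)) :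
    IsLinf fun θ => (S.slack γ K θ)⁻¹ := by
  obtain ⟨ε, hε, h⟩ := hpos
  exact isLinf_of_bound (aestronglyMeasurable_inv (isL1_slack hK).aestronglyMeasurable) ε⁻¹
    (h.mono fun θ hθ => norm_inv_apply_le hε hθ)

lemma normTrace_inv_slack (hK : K ∈ S.causal) (hpos : IsPosDefOp (S.slack γ K)) :
    normTrace (S.slack γ K)⁻¹ = ∫ θ, ((S.slack γ K θ)⁻¹).trace.re ∂circleHaar :=
  (isLinf_inv_slack hK hpos).isL2.isL1.normTrace_eq

lemma payoff_integrand (θ : UnitAddCircle) : γ⁻¹ * (S.regretOp K θ * M θ).trace.re =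
    (M θ).trace.re - (M θ * S.slack γ K θ).trace.re := by
  rw [slack_apply, Matrix.mul_sub, Matrix.mul_one, Matrix.mul_smul, trace_sub, trace_smul,
    trace_mul_comm (M θ), smul_eq_mul, Complex.sub_re, Complex.re_ofReal_mul]
  ring

/-- Weak duality. -/
lemma payoff_le_normTrace_inv (hK : K ∈ S.causal) (hpos : IsPosDefOp (S.slack γ K))
    (hM : IsLinf M) (hM' : ∀ᵐ θ ∂circleHaar, (M θ).PosSemidef) :
    S.payoff γ K M ≤ normTrace (S.slack γ K)⁻¹ := by
  rw [payoff_eq_integral hK hM hM', normTrace_inv_slack hK hpos]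
  refine integral_mono_ae (integrable_payoff hK hM hM')
    (isLinf_inv_slack hK hpos).isL2.isL1.re_trace ?_
  obtain ⟨ε, hε, h⟩ := hpos
  filter_upwards [h, hM'] with θ h1 h2
  have := two_mul_re_trace_sqrt_le h2 (posDef_of_sub_smul_one hε h1)
  simp only [payoff_integrand]
  linarith

/-- The worst-case `M` for a strictly feasible controller. -/
lemma exists_payoff_eq_normTrace_inv (hγ : 0 < γ) (hK : K ∈ S.causal)
    (hpos : IsPosDefOp (S.slack γ K)) :
    ∃ M ∈ geOne p, S.payoff γ K M = normTrace (S.slack γ K)⁻¹ := by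
  have hb := isLinf_inv_slack hK hpos
  rw [normTrace_inv_slack hK hpos]
  have hm := aestronglyMeasurable_matrix_mul hb.aestronglyMeasurable hb.aestronglyMeasurable
  obtain ⟨c, hc⟩ := hb.exists_bound
  obtain ⟨ε, hε, h⟩ := hpos
  -- Equality in Fenchel's inequality occurs when `√M` is the inverse slack, so `M = Q²`.
  set Q : ToeplitzSymbol (Fin p) (Fin p) := fun θ => (S.slack γ K θ)⁻¹ with hQ
  have hMb : IsLinf fun θ => Q θ * Q θ := by
    refine isLinf_of_bound hm (∑ _k : Fin p, c * c) (hc.mono fun θ hθ i j => ?_)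
    rw [mul_apply]
    refine (norm_sum_le _ _).trans (Finset.sum_le_sum fun k _ => ?_)
    rw [norm_mul]
    exact mul_le_mul (hθ i k) (hθ k j) (norm_nonneg _) ((norm_nonneg _).trans (hθ i k))
  have hge : ∀ᵐ θ ∂circleHaar, (Q θ * Q θ - 1).PosSemidef := h.mono fun θ hθ =>
    posSemidef_inv_mul_inv_sub_one (posDef_of_sub_smul_one hε hθ) (one_sub_slack_posSemidef hγ θ)
  have hsymm : IsConjSymm fun θ => Q θ * Q θ := by
    filter_upwards [isConjSymm_slack (γ := γ) hK] with θ hθ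
    simp only [hQ]
    rw [hθ, map_conj_mul, map_conj_inv]
  refine ⟨fun θ => Q θ * Q θ, ⟨⟨hMb, hsymm.isRealOp⟩, hge⟩, ?_⟩
  rw [payoff_eq_integral hK hMb (hge.mono fun θ hθ => (posDef_of_sub_one_posSemidef hθ).posSemidef)]
  refine integral_congr_ae (h.mono fun θ hθ => ?_)
  have hpd := posDef_of_sub_smul_one hε hθ
  have hdet : IsUnit (S.slack γ K θ).det := (isUnit_iff_isUnit_det _).1 hpd.isUnit
  simp only [payoff_integrand (M := fun θ => Q θ * Q θ)]
  rw [CFC.sqrt_mul_self (Q θ) hpd.inv.posSemidef.nonneg, Matrix.mul_assoc,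
    nonsing_inv_mul _ hdet, Matrix.mul_one]
  ring

/-- A controller with finite worst case over all `M ≥ I` satisfies `C_K ≤ γ I`. -/
lemma ae_slack_posSemidef (hK : K ∈ S.causal) {v : ℝ}
    (hv : ∀ M ∈ geOne p, S.payoff γ K M ≤ v) :
    ∀ᵐ θ ∂circleHaar, (S.slack γ K θ).PosSemidef := by
  refine ae_posSemidef_of_integral_nonneg (isL1_slack hK)
    (Eventually.of_forall fun θ => isHermitian_slack θ) (isConjSymm_slack hK) fun H hH hHs hHp => ?_
  have hint := ((isL1_slack (γ := γ) hK).mul hH).re_trace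
  have hint1 : Integrable (fun θ => -(S.slack γ K θ).trace.re) circleHaar :=
    (isL1_slack hK).re_trace.neg
  -- Evaluate the payoff at `M = I + s H` and discard `2 tr √M ≥ 0`. A negative pairing with `H`
  -- would make the left side exceed `v` for large `s`.
  have key : ∀ s > 0, -∫ θ, (S.slack γ K θ).trace.re ∂circleHaar -
      s * ∫ θ, (S.slack γ K θ * H θ).trace.re ∂circleHaar ≤ v := by
    intro s hs
    set M : ToeplitzSymbol (Fin p) (Fin p) := fun θ => 1 + (s : ℂ) • H θ with hM
    have hMb : IsLinf M := (isLinf_const 1).add (hH.smul _)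
    have hMs : IsConjSymm M := by
      filter_upwards [hHs] with θ hθ
      simp only [hM]
      rw [hθ, map_conj_add, map_conj_one, map_conj_smul_real]
    have hge : ∀ θ, (M θ - 1).PosSemidef := fun θ => by
      simp only [hM, add_sub_cancel_left]
      exact (hHp θ).smul_ofReal hs.le
    have hpos : ∀ θ, (M θ).PosSemidef := fun θ => (posDef_of_sub_one_posSemidef (hge θ)).posSemidef
    refine le_trans ?_ (hv M ⟨⟨hMb, hMs.isRealOp⟩, Eventually.of_forall hge⟩)
    rw [payoff_eq_integral hK hMb (Eventually.of_forall hpos), ← integral_neg,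
      ← integral_const_mul, ← integral_sub hint1 (hint.const_mul _)]
    refine integral_mono (hint1.sub (hint.const_mul _))
      (integrable_payoff hK hMb (Eventually.of_forall hpos)) fun θ => ?_
    have h1 := (posSemidef_sqrt (M θ)).re_trace_nonneg
    have h2 : (M θ * S.slack γ K θ).trace.re =
        (S.slack γ K θ).trace.re + s * (S.slack γ K θ * H θ).trace.re := by
      simp only [hM]
      rw [Matrix.add_mul, Matrix.one_mul, Matrix.smul_mul, trace_add, trace_smul,
        trace_mul_comm (H θ), smul_eq_mul, Complex.add_re, Complex.re_ofReal_mul]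
    simp only [payoff_integrand, h2]
    linarith
  by_contra! hneg
  set I := ∫ θ, (S.slack γ K θ * H θ).trace.re ∂circleHaar
  set J := ∫ θ, (S.slack γ K θ).trace.re ∂circleHaar
  have h1 := key ((|v + J| + 1) / (-I)) (by have := neg_pos.2 hneg; positivity)
  have h2 : (|v + J| + 1) / (-I) * I = -(|v + J| + 1) := by
    rw [div_neg, neg_mul, div_mul_cancel₀ _ hneg.ne]
  rw [h2] at h1
  linarith [le_abs_self (v + J)]

/-- The slack is operator concave in the controller, so the margin `ε` of `K'` survives as `t * ε`.
-/
lemma isPosDefOp_slack_comb (hγ : 0 < γ) (hK : ∀ᵐ θ ∂circleHaar, (S.slack γ K θ).PosSemidef)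
    (hK' : IsPosDefOp (S.slack γ K')) {t : ℝ} (ht : t ∈ Set.Ioo (0 : ℝ) 1) :
    IsPosDefOp (S.slack γ (comb K K' t)) := by
  obtain ⟨ε, hε, h⟩ := hK'
  refine ⟨t * ε, mul_pos ht.1 hε, ?_⟩
  filter_upwards [hK, h] with θ h1 h2
  have h3 := posSemidef_conjTranspose_mul_self (S.closedLoop K' θ - S.closedLoop K θ)
  have h4 := ((h1.smul_ofReal (sub_nonneg.2 ht.2.le)).add (h2.smul_ofReal ht.1.le)).add
    (h3.smul_ofReal (c := γ⁻¹ * (t * (1 - t)))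
      (mul_nonneg (inv_nonneg.2 hγ.le) (mul_nonneg ht.1.le (sub_nonneg.2 ht.2.le))))
  convert h4 using 1
  rw [slack_apply, slack_apply, slack_apply, regretOp_comb]
  ext i j
  simp only [Matrix.add_apply, Matrix.sub_apply, Matrix.smul_apply, smul_eq_mul]
  push_cast
  ring

lemma exists_isPosDefOp_slack (hγ : S.gammaRO < ENNReal.ofReal γ) :
    ∃ K ∈ S.causal, IsPosDefOp (S.slack γ K) := by
  have hγ0 : 0 < γ := ENNReal.ofReal_pos.1 (pos_of_gt hγ)
  simp only [gammaRO, iInf_lt_iff] at hγ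
  obtain ⟨K, hK, hlt⟩ := hγ
  refine ⟨K, hK, (isPosDefOp_slack_iff hγ0).2 ?_⟩
  have hfin : opNorm (S.regretOp K) ≠ ∞ := (hlt.trans ENNReal.ofReal_lt_top).ne
  refine ⟨γ - (opNorm (S.regretOp K)).toReal, sub_pos.2 ?_, ?_⟩
  · rwa [← ENNReal.lt_ofReal_iff_toReal_lt hfin]
  · have hae : ∀ᵐ θ ∂circleHaar,
        ‖(Matrix.toEuclideanLin (S.regretOp K θ)).toContinuousLinearMap‖ₑ ≤
          opNorm (S.regretOp K) := ENNReal.ae_le_essSup _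
    refine hae.mono fun θ hθ => ?_
    have h1 : ‖(Matrix.toEuclideanLin (S.regretOp K θ)).toContinuousLinearMap‖ ≤
        (opNorm (S.regretOp K)).toReal := by
      rw [← toReal_enorm]
      exact ENNReal.toReal_mono hfin hθ
    convert posSemidef_smul_one_sub_of_norm_le (S.regretOp_posSemidef K θ).isHermitian h1 using 1
    simp only [Pi.sub_apply, Pi.smul_apply, Pi.one_apply]
    push_cast
    rw [sub_smul]
    abel

lemma one_mem_geOne : (fun _ => 1 : ToeplitzSymbol (Fin p) (Fin p)) ∈ geOne p := by
  have hs : IsConjSymm fun _ => (1 : Matrix (Fin p) (Fin p) ℂ) :=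
    Eventually.of_forall fun θ => map_conj_one.symm
  exact ⟨⟨isLinf_const 1, hs.isRealOp⟩, Eventually.of_forall fun θ => by
    simpa using PosSemidef.zero⟩

/-- Strong duality. -/
theorem iInf_normTrace_inv_le_iSup_payoff (hγ : S.gammaRO < ENNReal.ofReal γ) :
    (⨅ K ∈ {K | K ∈ S.causal ∧ IsPosDefOp (S.slack γ K)},
        ((normTrace (S.slack γ K)⁻¹ : ℝ) : EReal)) ≤
      ⨆ M ∈ geOne p, ⨅ K ∈ S.causal, (S.payoff γ K M : EReal) := by
  have hγ0 : 0 < γ := ENNReal.ofReal_pos.1 (pos_of_gt hγ)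
  obtain ⟨K₀, hK₀, hpos₀⟩ := exists_isPosDefOp_slack hγ
  have hweak : ∀ M ∈ geOne p, S.payoff γ K₀ M ≤ normTrace (S.slack γ K₀)⁻¹ := fun M hM =>
    payoff_le_normTrace_inv hK₀ hpos₀ hM.1.1
      (hM.2.mono fun θ hθ => (posDef_of_sub_one_posSemidef hθ).posSemidef)
  -- The maximin value is finite: weak duality at `K₀` bounds it above, and `M = I` bounds it below.
  obtain ⟨v, hv⟩ : ∃ v : ℝ, (v : EReal) =
      ⨆ M ∈ geOne p, ⨅ K ∈ S.causal, (S.payoff γ K M : EReal) := by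
    refine ⟨_, EReal.coe_toReal (ne_of_lt ?_) (ne_of_gt ?_)⟩
    · refine lt_of_le_of_lt (iSup₂_le fun M hM => ?_)
        (EReal.coe_lt_top (normTrace (S.slack γ K₀)⁻¹))
      exact (iInf₂_le K₀ hK₀).trans (EReal.coe_le_coe_iff.2 (hweak M hM))
    · refine lt_of_lt_of_le
        (EReal.bot_lt_coe (∫ _θ, -(1 : Matrix (Fin p) (Fin p) ℂ).trace.re ∂circleHaar)) ?_
      refine le_iSup₂_of_le _ one_mem_geOne (le_iInf₂ fun K hK => EReal.coe_le_coe_iff.2 ?_)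
      exact integral_neg_trace_le_payoff hγ0 hK (isLinf_const 1)
        (Eventually.of_forall fun θ => PosSemidef.one)
  obtain ⟨K, hK, hKv⟩ := exists_causal_forall_payoff_le (S := S) (v := v) hγ0
    (fun M hM η hη => by
      have h1 : ⨅ K ∈ S.causal, (S.payoff γ K M : EReal) < ((v + η : ℝ) : EReal) :=
        lt_of_le_of_lt (hv ▸ le_iSup₂ (f := fun M (_ : M ∈ geOne p) =>
          ⨅ K ∈ S.causal, (S.payoff γ K M : EReal)) M hM)
          (EReal.coe_lt_coe_iff.2 (lt_add_of_pos_right v hη))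
      simp only [iInf_lt_iff] at h1
      obtain ⟨K, hK, h⟩ := h1
      exact ⟨K, hK, (EReal.coe_lt_coe_iff.1 h).le⟩)
    (fun η hη => by
      have h1 : ((v - η : ℝ) : EReal) < ⨆ M ∈ geOne p, ⨅ K ∈ S.causal, (S.payoff γ K M : EReal) :=
        hv ▸ EReal.coe_lt_coe_iff.2 (sub_lt_self v hη)
      simp only [lt_iSup_iff] at h1
      obtain ⟨M, hM, h⟩ := h1
      exact ⟨M, hM, fun K hK => EReal.coe_le_coe_iff.1 (h.le.trans (iInf₂_le K hK))⟩)
  have hslack := ae_slack_posSemidef hK hKv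
  rw [← hv]
  set J := normTrace (S.slack γ K₀)⁻¹ with hJ
  have hle : ∀ t ∈ Set.Ioo (0 : ℝ) 1,
      (⨅ K ∈ {K | K ∈ S.causal ∧ IsPosDefOp (S.slack γ K)},
        ((normTrace (S.slack γ K)⁻¹ : ℝ) : EReal)) ≤ (((1 - t) * v + t * J : ℝ) : EReal) := by
    intro t ht
    have hmem := S.comb_mem_causal hK hK₀ t
    have hpos := isPosDefOp_slack_comb hγ0 hslack hpos₀ ht
    refine (iInf₂_le (comb K K₀ t) ⟨hmem, hpos⟩).trans (EReal.coe_le_coe_iff.2 ?_)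
    obtain ⟨M, hM, hMeq⟩ := exists_payoff_eq_normTrace_inv hγ0 hmem hpos
    have hM' := hM.2.mono fun θ hθ => (posDef_of_sub_one_posSemidef hθ).posSemidef
    -- The worst `M` for the mixture is held fixed: the payoff is then convex in the controller, at
    -- most `v` at `K` and at most `J` at `K₀`.
    rw [← hMeq, payoff_comb hK hK₀ hM.1.1 hM']
    have h1 := mul_le_mul_of_nonneg_left (hKv M hM) (sub_nonneg.2 ht.2.le)
    have h2 := mul_le_mul_of_nonneg_left (hweak M hM) ht.1.le
    have h3 : 0 ≤ ∫ θ, ((S.closedLoop K₀ θ - S.closedLoop K θ)ᴴ *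
        (S.closedLoop K₀ θ - S.closedLoop K θ) * M θ).trace.re ∂circleHaar :=
      integral_nonneg_of_ae (hM'.mono fun θ hθ =>
        (posSemidef_conjTranspose_mul_self _).re_trace_mul_nonneg hθ)
    have h4 := mul_nonneg (mul_nonneg ht.1.le (sub_nonneg.2 ht.2.le))
      (mul_nonneg (inv_nonneg.2 hγ0.le) h3)
    linarith
  have hlim : Tendsto (fun t : ℝ => (((1 - t) * v + t * J : ℝ) : EReal)) (𝓝[>] 0)
      (𝓝 (v : EReal)) := by
    have hc : Continuous fun t : ℝ => (((1 - t) * v + t * J : ℝ) : EReal) :=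
      continuous_coe_real_ereal.comp (by fun_prop)
    have := (hc.tendsto 0).mono_left (nhdsWithin_le_nhds (s := Set.Ioi 0))
    simpa using this
  exact ge_of_tendsto hlim
    (Filter.eventually_of_mem (Ioo_mem_nhdsGT one_pos) hle)

end LTISystem

end DRRO

end

theorem mainTheorem5 {n d p : ℕ} (S : DRRO.LTISystem n d p)
    (hBu : DRRO.Stabilizable S.A S.Bu) (hBw : DRRO.Stabilizable S.A S.Bw)
    (γ : ℝ) (hγ : S.gammaRO < ENNReal.ofReal γ) :
    (⨅ K ∈ {K : DRRO.ToeplitzSymbol (Fin d) (Fin p) |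
          K ∈ S.causal ∧ DRRO.IsPosDefOp ((γ : ℂ) • 1 - S.regretOp K)},
        ((DRRO.normTrace (1 - ((γ : ℂ)⁻¹) • S.regretOp K)⁻¹ : ℝ) : EReal)) =
      ⨆ M ∈ {M : DRRO.ToeplitzSymbol (Fin p) (Fin p) | DRRO.IsBoundedOp M ∧ DRRO.IsPosDefOp M},
        ⨅ K ∈ S.causal,
          ((-DRRO.normTrace M + 2 * DRRO.normTrace (DRRO.sqrtOp M)
            + γ⁻¹ * DRRO.normTrace (S.regretOp K * M) : ℝ) : EReal) := by
  have hγ0 : 0 < γ := ENNReal.ofReal_pos.1 (pos_of_gt hγ)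
  simp only [← DRRO.LTISystem.isPosDefOp_slack_iff hγ0]
  apply le_antisymm
  · refine (DRRO.LTISystem.iInf_normTrace_inv_le_iSup_payoff hγ).trans ?_
    exact iSup₂_le fun M hM => le_iSup₂_of_le (f := fun M
      (_ : M ∈ {M : DRRO.ToeplitzSymbol (Fin p) (Fin p) | DRRO.IsBoundedOp M ∧ DRRO.IsPosDefOp M}) =>
        ⨅ K ∈ S.causal, (S.payoff γ K M : EReal)) M
      ⟨hM.1, DRRO.LTISystem.isPosDefOp_of_geOne hM⟩ le_rfl
  · refine iSup₂_le fun M hM => le_iInf₂ fun K hK => (iInf₂_le K hK.1).trans ?_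
    exact EReal.coe_le_coe_iff.2 (DRRO.LTISystem.payoff_le_normTrace_inv hK.1 hK.2 hM.1.1
      (DRRO.LTISystem.ae_posSemidef_of_isPosDefOp hM.2))
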